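/- Let $d\ge 1$, let $u\in\mathbb C$ with $u\neq 0$, and let $n\ge 3$. Let $\mathrm Y_{d,n}(u)$ be the Yokonuma--Hecke algebra of type $A$ over $\mathbb C$, with generators $g_1,\dots,g_{n-1},t_1,\dots,t_n$, the braid relations for the $g_i$, and the relations $t_it_j=t_jt_i$, $t_jg_i=g_it_{s_i(j)}$, $t_i^d=1$ and $g_i^2=1+(u-1)e_i+(u-1)e_ig_i$, where $e_i=\frac1d\sum_{s=0}^{d-1}t_i^st_{i+1}^{d-s}$. For $z\in\mathbb C$ and $x:\mathbb Z/d\mathbb Z\to\mathbb C$ with $x_0=1$, let $\mathrm{tr}$ be the Juyumaya trace with parameters $z,x_1,\dots,x_{d-1}$, that is, the linear functional on the inductive limit $\bigcup_n\mathrm Y_{d,n}(u)$ with $\mathrm{tr}(1)=1$, $\mathrm{tr}(ab)=\mathrm{tr}(ba)$, $\mathrm{tr}(ag_n)=z\,\mathrm{tr}(a)$ and $\mathrm{tr}(at_{n+1}^m)=x_m\mathrm{tr}(a)$ for $a,b\in\mathrm Y_{d,n}(u)$ and $1\le m\le d-1$; there is at most one such functional for given parameters. Let $\mathrm{FTL}_{d,n}(u)$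 be the quotient of $\mathrm Y_{d,n}(u)$ by the two-sided ideal generated by all $$r_{i,i+1}=\sum_{\alpha+\beta+\gamma=0}t_i^\alpha t_{i+1}^\beta t_{i+2}^\gamma\,(g_ig_{i+1}g_i+g_{i+1}g_i+g_ig_{i+1}+g_i+g_{i+1}+1),$$ the sum being over $\alpha,\beta,\gamma\in\mathbb Z/d\mathbb Z$. The trace with parameters $(z,x)$ \emph{passes} to $\mathrm{FTL}_{d,n}(u)$ if $\mathrm{tr}$ (exists and) factors through $\mathrm{FTL}_{d,n}(u)$ on $\mathrm Y_{d,n}(u)$. The E-system is $\sum_s x_{m+s}x_{-s}=x_m\sum_s x_sx_{-s}$ for all $m\ne0$ in $\mathbb Z/d\mathbb Z$, with $x_0=1$. Its solutions are exactly the functions $x^D_m=\frac1{|D|}\sum_{k\in D}e^{2\pi ikm/d}$ for $D\subseteq\mathbb Z/d\mathbb Z$ non-empty, and $D$ is determined by $x^D$. Let $y_k=\sum_m x_me^{-2\pi ikm/d}$ be the Fourier transform of $x$ and put $$D_1=\{k: y_k\ne0,\ y_k=-dz\},\qquad D_2=\{k: y_k\neq0,\ y_k=-dz(u+1)\}.$$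 (1) Suppose that the trace with parameters $(z,x)$ passes to $\mathrm{FTL}_{d,n}(u)$. Then $D_1=\emptyset$ or $D_2=\emptyset$ if and only if $x$ solves the E-system. If $D_1=\emptyset$, then $D_2\neq\emptyset$, $x=x^{D_2}$, $u\ne-1$ and $z=-\frac1{(u+1)|D_2|}$. If $D_2=\emptyset$, then $D_1\ne\emptyset$, $x=x^{D_1}$ and $z=-\frac1{|D_1|}$. (2) Conversely, let $D$ be a non-empty subset of $\mathbb Z/d\mathbb Z$. If $u\ne-1$ and $z=-\frac1{(u+1)|D|}$, then the trace with parameters $(z,x^D)$ passes to $\mathrm{FTL}_{d,n}(u)$, with $D_1=\emptyset$ and $D_2=D$. If $z=-\frac1{|D|}$, then the trace with parameters $(z,x^D)$ passes to $\mathrm{FTL}_{d,n}(u)$, with $D_2=\emptyset$ and $D_1=D$. (3) Consequently the framed Jones polynomial can be defined: let $u\ne-1$, let $D$ be non-empty, $z=-\frac1{(u+1)|D|}$, and let $\mathrm{tr}_D$ be the trace with parameters $(z,x^D)$. Then $\lambda_D:=\frac{|D|z+1-u}{|D|uz}$ equals $u$, and for each choice of $\sqrt u$ the number $$\Big(\frac1{z\sqrt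 u}\Big)^{N-1}(\sqrt u)^{\epsilon(\alpha)}\,\mathrm{tr}_D(\gamma(\alpha)),$$ for $\alpha$ in the framed braid group $\mathcal F_N$, $N\ge1$, depends only on the class of $\alpha$ under framed braid equivalence (generated by conjugation in the groups $\mathcal F_N$ and $\alpha\sim\alpha\sigma_N^{\pm1}$, $\alpha\in\mathcal F_N$), that is, on the oriented framed link that is the closure of $\alpha$. Here $\epsilon(\alpha)$ is the exponent sum of the $\sigma_i$ in $\alpha$ and $\gamma$ is the representation $\sigma_i\mapsto g_i$, $t_j\mapsto t_j$. -/

import Mathlib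

open scoped BigOperators

namespace FramizationTL

noncomputable section

/-! Strands and residues are numbered from `0`: the braiding generator `g i` crosses the strands
`i` and `i + 1`, and `t j` is the framing generator on the strand `j`. -/

/-- The generators on `n` strands: `n - 1` braiding ones and `n` framing ones. -/
inductive Gen (n : ℕ) : Type
  | g (i : ℕ) (hi : i + 1 < n) : Gen n
  | t (j : Fin n) : Gen n

/-- The transposition `s_i` of the strands `i` and `i + 1`. -/
def strandSwap {n : ℕ} (i : ℕ) (hi : i + 1 < n) : Equiv.Perm (Fin n) :=
  Equiv.swap ⟨i, Nat.lt_of_succ_lt hi⟩ ⟨i + 1, hi⟩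

/-! ### The Yokonuma--Hecke algebra -/

/-- The element `(1/d) ∑_{s=0}^{d-1} a^s b^(d-s)` of a complex algebra. -/
def framingAverage {A : Type*} [Ring A] [Algebra ℂ A] (d : ℕ) (a b : A) : A :=
  (d : ℂ)⁻¹ • ∑ s ∈ Finset.range d, a ^ s * b ^ (d - s)

/-- A generator as an element of the free algebra. -/
abbrev fg {n : ℕ} (i : ℕ) (hi : i + 1 < n) : FreeAlgebra ℂ (Gen n) :=
  FreeAlgebra.ι ℂ (Gen.g i hi)

/-- A generator as an element of the free algebra. -/
abbrev ft {n : ℕ} (j : Fin n) : FreeAlgebra ℂ (Gen n) :=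
  FreeAlgebra.ι ℂ (Gen.t j)

/-- The free-algebra word for `e_i`. -/
def fe (d : ℕ) {n : ℕ} (i : ℕ) (hi : i + 1 < n) : FreeAlgebra ℂ (Gen n) :=
  framingAverage d (ft ⟨i, Nat.lt_of_succ_lt hi⟩) (ft ⟨i + 1, hi⟩)

/-- The defining relations of the Yokonuma--Hecke algebra `Y_{d,n}(u)`. -/
inductive YHRel (d : ℕ) (u : ℂ) (n : ℕ) :
    FreeAlgebra ℂ (Gen n) → FreeAlgebra ℂ (Gen n) → Prop
  | far (i j : ℕ) (hi : i + 1 < n) (hj : j + 1 < n) (hij : i + 1 < j) :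
      YHRel d u n (fg i hi * fg j hj) (fg j hj * fg i hi)
  | braid (i : ℕ) (hi : i + 1 < n) (hj : i + 1 + 1 < n) :
      YHRel d u n (fg i hi * fg (i + 1) hj * fg i hi) (fg (i + 1) hj * fg i hi * fg (i + 1) hj)
  | framing_comm (i j : Fin n) : YHRel d u n (ft i * ft j) (ft j * ft i)
  | framing_braid (i : ℕ) (hi : i + 1 < n) (j : Fin n) :
      YHRel d u n (ft j * fg i hi) (fg i hi * ft (strandSwap i hi j))
  | framing_pow (j : Fin n) : YHRel d u n (ft j ^ d) 1
  | quadratic (i : ℕ) (hi : i + 1 < n) :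
      YHRel d u n (fg i hi ^ 2) (1 + (u - 1) • fe d i hi + (u - 1) • (fe d i hi * fg i hi))

/-- The Yokonuma--Hecke algebra `Y_{d,n}(u)` of type `A`. -/
abbrev YH (d : ℕ) (u : ℂ) (n : ℕ) : Type := RingQuot (YHRel d u n)

/-- The quotient map from the free algebra. -/
def YH.mk (d : ℕ) (u : ℂ) (n : ℕ) : FreeAlgebra ℂ (Gen n) →ₐ[ℂ] YH d u n :=
  RingQuot.mkAlgHom ℂ (YHRel d u n)

/-- The braiding generator `g_i` of `Y_{d,n}(u)`. -/
def YH.g {d : ℕ} {u : ℂ} {n : ℕ} (i : ℕ) (hi : i + 1 < n) : YH d u n := YH.mk d u n (fg i hi)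

/-- The framing generator `t_j` of `Y_{d,n}(u)`. -/
def YH.t {d : ℕ} {u : ℂ} {n : ℕ} (j : Fin n) : YH d u n := YH.mk d u n (ft j)

/-- The element `e_i` of `Y_{d,n}(u)`. -/
def YH.e {d : ℕ} {u : ℂ} {n : ℕ} (i : ℕ) (hi : i + 1 < n) : YH d u n :=
  framingAverage d (YH.t ⟨i, Nat.lt_of_succ_lt hi⟩) (YH.t ⟨i + 1, hi⟩)

lemma map_framingAverage {A B : Type*} [Ring A] [Algebra ℂ A] [Ring B] [Algebra ℂ B]
    (f : A →ₐ[ℂ] B) (d : ℕ) (a b : A) :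
    f (framingAverage d a b) = framingAverage d (f a) (f b) := by
  simp [framingAverage, map_sum]

lemma YH.mk_fe {d : ℕ} {u : ℂ} {n : ℕ} (i : ℕ) (hi : i + 1 < n) :
    YH.mk d u n (fe d i hi) = YH.e i hi := map_framingAverage _ _ _ _

section relations

variable {d : ℕ} {u : ℂ} {n : ℕ}

lemma YH.far (i j : ℕ) (hi : i + 1 < n) (hj : j + 1 < n) (hij : i + 1 < j) :
    (YH.g i hi * YH.g j hj : YH d u n) = YH.g j hj * YH.g i hi := by
  have h : YH.mk d u n _ = YH.mk d u n _ :=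
    RingQuot.mkAlgHom_rel ℂ (YHRel.far (d := d) (u := u) i j hi hj hij)
  simp only [map_mul] at h
  exact h

lemma YH.braid (i : ℕ) (hi : i + 1 < n) (hj : i + 1 + 1 < n) :
    (YH.g i hi * YH.g (i + 1) hj * YH.g i hi : YH d u n)
      = YH.g (i + 1) hj * YH.g i hi * YH.g (i + 1) hj := by
  have h : YH.mk d u n _ = YH.mk d u n _ :=
    RingQuot.mkAlgHom_rel ℂ (YHRel.braid (d := d) (u := u) i hi hj)
  simp only [map_mul] at h
  exact h

lemma YH.framing_comm (i j : Fin n) : (YH.t i * YH.t j : YH d u n) = YH.t j * YH.t i := by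
  have h : YH.mk d u n _ = YH.mk d u n _ :=
    RingQuot.mkAlgHom_rel ℂ (YHRel.framing_comm (d := d) (u := u) i j)
  simp only [map_mul] at h
  exact h

lemma YH.framing_braid (i : ℕ) (hi : i + 1 < n) (j : Fin n) :
    (YH.t j * YH.g i hi : YH d u n) = YH.g i hi * YH.t (strandSwap i hi j) := by
  have h : YH.mk d u n _ = YH.mk d u n _ :=
    RingQuot.mkAlgHom_rel ℂ (YHRel.framing_braid (d := d) (u := u) i hi j)
  simp only [map_mul] at h
  exact h

lemma YH.framing_pow (j : Fin n) : (YH.t j ^ d : YH d u n) = 1 := by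
  have h : YH.mk d u n _ = YH.mk d u n _ :=
    RingQuot.mkAlgHom_rel ℂ (YHRel.framing_pow (d := d) (u := u) j)
  simp only [map_pow, map_one] at h
  exact h

lemma YH.quadratic (i : ℕ) (hi : i + 1 < n) :
    (YH.g i hi ^ 2 : YH d u n)
      = 1 + (u - 1) • YH.e i hi + (u - 1) • (YH.e i hi * YH.g i hi) := by
  have h := RingQuot.mkAlgHom_rel ℂ (YHRel.quadratic (d := d) (u := u) i hi)
  change YH.mk d u n _ = YH.mk d u n _ at h
  simp only [map_add, map_mul, map_pow, map_smul, map_one, YH.mk_fe] at h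
  exact h

end relations

lemma strandSwap_castSucc {n : ℕ} (i : ℕ) (hi : i + 1 < n) (j : Fin n) :
    (strandSwap i hi j).castSucc = strandSwap i (Nat.lt_succ_of_lt hi) j.castSucc := by
  unfold strandSwap
  rw [(Fin.castSucc_injective n).map_swap]
  rfl

/-- The images of the generators under the embedding `Y_{d,n}(u) → Y_{d,n+1}(u)`. -/
def YH.inclGen (d : ℕ) (u : ℂ) (n : ℕ) : Gen n → YH d u (n + 1)
  | Gen.g i hi => YH.g i (Nat.lt_succ_of_lt hi)
  | Gen.t j => YH.t j.castSucc

lemma YH.inclGen_rel (d : ℕ) (u : ℂ) (n : ℕ) ⦃a b : FreeAlgebra ℂ (Gen n)⦄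
    (h : YHRel d u n a b) :
    FreeAlgebra.lift ℂ (YH.inclGen d u n) a = FreeAlgebra.lift ℂ (YH.inclGen d u n) b := by
  have he (i : ℕ) (hi : i + 1 < n) :
      FreeAlgebra.lift ℂ (YH.inclGen d u n) (fe d i hi) = YH.e i (Nat.lt_succ_of_lt hi) := by
    rw [fe, map_framingAverage, FreeAlgebra.lift_ι_apply, FreeAlgebra.lift_ι_apply]
    rfl
  cases h with
  | far i j hi hj hij => simpa [YH.inclGen] using YH.far i j _ _ hij
  | braid i hi hj => simpa [YH.inclGen] using YH.braid i _ _
  | framing_comm i j => simpa [YH.inclGen] using YH.framing_comm _ _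
  | framing_braid i hi j =>
      simpa [YH.inclGen, strandSwap_castSucc] using YH.framing_braid i _ j.castSucc
  | framing_pow j => simpa [YH.inclGen] using YH.framing_pow _
  | quadratic i hi =>
      simp only [map_add, map_mul, map_pow, map_smul, map_one, he, FreeAlgebra.lift_ι_apply]
      exact YH.quadratic i _

/-- The embedding `Y_{d,n}(u) → Y_{d,n+1}(u)` that adds a strand on the right. -/
def YH.incl (d : ℕ) (u : ℂ) (n : ℕ) : YH d u n →ₐ[ℂ] YH d u (n + 1) :=
  RingQuot.liftAlgHom ℂ ⟨FreeAlgebra.lift ℂ (YH.inclGen d u n), YH.inclGen_rel d u n⟩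

/-! ### The trace -/

/-- `tr` is the Juyumaya trace with parameters `z` and `x_1, …, x_{d-1}` (the values of `x` at
the nonzero residues): a linear functional on the inductive limit of the `Y_{d,n}(u)`, given by
a compatible family, with the trace property and the two Markov rules. -/
structure IsJuyumayaTrace (d : ℕ) (u z : ℂ) (x : ZMod d → ℂ)
    (tr : ∀ n, YH d u n →ₗ[ℂ] ℂ) : Prop where
  compatible : ∀ n (a : YH d u n), tr (n + 1) (YH.incl d u n a) = tr n a
  one : ∀ n, tr n 1 = 1
  mul_comm : ∀ n (a b : YH d u n), tr n (a * b) = tr n (b * a)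
  braiding : ∀ n (a : YH d u (n + 1)),
    tr (n + 2) (YH.incl d u (n + 1) a * YH.g n (Nat.lt_succ_self _)) = z * tr (n + 1) a
  framing : ∀ n (a : YH d u n) (m : ℕ), 1 ≤ m → m < d →
    tr (n + 1) (YH.incl d u n a * YH.t (Fin.last n) ^ m) = x (m : ZMod d) * tr n a

/-! ### The framization of the Temperley--Lieb algebra -/

/-- `g_{i,i+1} = g_i g_{i+1} g_i + g_{i+1} g_i + g_i g_{i+1} + g_i + g_{i+1} + 1`. -/
def YH.steinberg {d : ℕ} {u : ℂ} {n : ℕ} (i : ℕ) (hi : i + 2 < n) : YH d u n :=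
  let a : YH d u n := YH.g i (Nat.lt_of_succ_lt hi)
  let b : YH d u n := YH.g (i + 1) hi
  a * b * a + b * a + a * b + a + b + 1

/-- `r_{i,i+1} = ∑_{α+β+γ=0} t_i^α t_{i+1}^β t_{i+2}^γ g_{i,i+1}`, where `α, β, γ` run over the
residues modulo `d`. -/
def YH.r {d : ℕ} [NeZero d] {u : ℂ} {n : ℕ} (i : ℕ) (hi : i + 2 < n) : YH d u n :=
  (∑ α : ZMod d, ∑ β : ZMod d,
    YH.t ⟨i, Nat.lt_of_succ_lt (Nat.lt_of_succ_lt hi)⟩ ^ α.val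
      * YH.t ⟨i + 1, Nat.lt_of_succ_lt hi⟩ ^ β.val
      * YH.t ⟨i + 2, hi⟩ ^ (-α - β).val) * YH.steinberg i hi

/-- The two-sided ideal of `Y_{d,n}(u)` generated by all the `r_{i,i+1}`. -/
def ftlIdeal (d : ℕ) [NeZero d] (u : ℂ) (n : ℕ) : TwoSidedIdeal (YH d u n) :=
  TwoSidedIdeal.span {a | ∃ (i : ℕ) (hi : i + 2 < n), a = YH.r i hi}

/-- The framization of the Temperley--Lieb algebra, `FTL_{d,n}(u)`. -/
abbrev FTL (d : ℕ) [NeZero d] (u : ℂ) (n : ℕ) : Type := (ftlIdeal d u n).ringCon.Quotient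

/-- The quotient map `Y_{d,n}(u) → FTL_{d,n}(u)`. -/
def FTL.mk (d : ℕ) [NeZero d] (u : ℂ) (n : ℕ) : YH d u n →+* FTL d u n :=
  (ftlIdeal d u n).ringCon.mk'

/-- The Juyumaya trace with parameters `z` and `x` passes to `FTL_{d,n}(u)`. -/
def TracePasses (d : ℕ) [NeZero d] (u : ℂ) (n : ℕ) (z : ℂ) (x : ZMod d → ℂ) : Prop :=
  ∃ tr : ∀ n, YH d u n →ₗ[ℂ] ℂ, IsJuyumayaTrace d u z x tr ∧
    ∃ φ : FTL d u n →ₗ[ℂ] ℂ, ∀ a, φ (FTL.mk d u n a) = tr n a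

/-! ### The E-system -/

/-- `E^{(m)} = (1/d) ∑_{s=0}^{d-1} x_{m+s} x_{d-s}`, with indices modulo `d`. -/
def EVal {d : ℕ} [NeZero d] (x : ZMod d → ℂ) (m : ZMod d) : ℂ :=
  (d : ℂ)⁻¹ * ∑ s : ZMod d, x (m + s) * x (-s)

/-- `x` (with `x_0 = 1`) solves the E-system `E^{(m)} = x_m E^{(0)}`, `1 ≤ m ≤ d - 1`. -/
def IsESolution {d : ℕ} [NeZero d] (x : ZMod d → ℂ) : Prop :=
  x 0 = 1 ∧ ∀ m : ZMod d, m ≠ 0 → EVal x m = x m * EVal x 0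

/-- The solution of the E-system parametrized by `D`: `x_m = (1/|D|) ∑_{k ∈ D} exp(2πikm/d)`. -/
def eSolution {d : ℕ} [NeZero d] (D : Finset (ZMod d)) (m : ZMod d) : ℂ :=
  (D.card : ℂ)⁻¹ * ∑ k ∈ D, ZMod.stdAddChar (k * m)

open Classical in
/-- `D_1`: the part of the support of the Fourier transform `y` of `x` on which `y_k = -dz`. -/
def setD₁ {d : ℕ} [NeZero d] (z : ℂ) (x : ZMod d → ℂ) : Finset (ZMod d) :=
  {k | ZMod.dft x k ≠ 0 ∧ ZMod.dft x k = -(d * z)}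

open Classical in
/-- `D_2`: the part of the support of the Fourier transform `y` of `x` on which
`y_k = -dz(u+1)`. -/
def setD₂ {d : ℕ} [NeZero d] (u z : ℂ) (x : ZMod d → ℂ) : Finset (ZMod d) :=
  {k | ZMod.dft x k ≠ 0 ∧ ZMod.dft x k = -(d * z * (u + 1))}

/-! ### Framed braids -/

/-- A generator as an element of the free group. -/
abbrev gσ {n : ℕ} (i : ℕ) (hi : i + 1 < n) : FreeGroup (Gen n) := FreeGroup.of (Gen.g i hi)

/-- A generator as an element of the free group. -/
abbrev gτ {n : ℕ} (j : Fin n) : FreeGroup (Gen n) := FreeGroup.of (Gen.t j)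

/-- The defining relations of the framed braid group on `n` strands. -/
inductive FramedBraidRel (n : ℕ) : FreeGroup (Gen n) → FreeGroup (Gen n) → Prop
  | far (i j : ℕ) (hi : i + 1 < n) (hj : j + 1 < n) (hij : i + 1 < j) :
      FramedBraidRel n (gσ i hi * gσ j hj) (gσ j hj * gσ i hi)
  | braid (i : ℕ) (hi : i + 1 < n) (hj : i + 1 + 1 < n) :
      FramedBraidRel n (gσ i hi * gσ (i + 1) hj * gσ i hi)
        (gσ (i + 1) hj * gσ i hi * gσ (i + 1) hj)
  | framing_comm (i j : Fin n) : FramedBraidRel n (gτ i * gτ j) (gτ j * gτ i)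
  | framing_braid (i : ℕ) (hi : i + 1 < n) (j : Fin n) :
      FramedBraidRel n (gτ j * gσ i hi) (gσ i hi * gτ (strandSwap i hi j))

/-- The framed braid group `F_n`. -/
abbrev FramedBraidGroup (n : ℕ) : Type :=
  PresentedGroup {w : FreeGroup (Gen n) | ∃ a b, FramedBraidRel n a b ∧ w = a * b⁻¹}

/-- The homomorphism from `F_n` given by a map on generators that respects the relations. -/
def FramedBraidGroup.lift {n : ℕ} {G : Type*} [Group G] (f : Gen n → G)
    (h : ∀ a b, FramedBraidRel n a b → FreeGroup.lift f a = FreeGroup.lift f b) :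
    FramedBraidGroup n →* G :=
  PresentedGroup.toGroup (f := f) (by
    rintro w ⟨a, b, hab, rfl⟩
    rw [map_mul, map_inv, h a b hab, mul_inv_cancel])

/-- The braiding generator `σ_i` of `F_n`. -/
def FramedBraidGroup.σ {n : ℕ} (i : ℕ) (hi : i + 1 < n) : FramedBraidGroup n :=
  PresentedGroup.of (Gen.g i hi)

/-- The framing generator `t_j` of `F_n`. -/
def FramedBraidGroup.t {n : ℕ} (j : Fin n) : FramedBraidGroup n :=
  PresentedGroup.of (Gen.t j)

lemma FramedBraidGroup.rel {n : ℕ} {a b : FreeGroup (Gen n)} (h : FramedBraidRel n a b) :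
    (PresentedGroup.mk _ a : FramedBraidGroup n) = PresentedGroup.mk _ b :=
  (PresentedGroup.mk_eq_mk_of_mul_inv_mem ⟨a, b, h, rfl⟩)

/-- The images of the generators under the embedding `F_n → F_{n+1}`. -/
def FramedBraidGroup.inclGen (n : ℕ) : Gen n → FramedBraidGroup (n + 1)
  | Gen.g i hi => FramedBraidGroup.σ i (Nat.lt_succ_of_lt hi)
  | Gen.t j => FramedBraidGroup.t j.castSucc

/-- The embedding `F_n → F_{n+1}` that adds a strand with framing `0` on the right. -/
def FramedBraidGroup.incl (n : ℕ) : FramedBraidGroup n →* FramedBraidGroup (n + 1) :=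
  FramedBraidGroup.lift (FramedBraidGroup.inclGen n) (by
    intro a b h
    cases h with
    | far i j hi hj hij =>
        have h := FramedBraidGroup.rel (.far i j (Nat.lt_succ_of_lt hi) (Nat.lt_succ_of_lt hj) hij)
        simp only [map_mul] at h
        simp only [map_mul, FreeGroup.lift_apply_of]
        exact h
    | braid i hi hj =>
        have h := FramedBraidGroup.rel (.braid i (Nat.lt_succ_of_lt hi) (Nat.lt_succ_of_lt hj))
        simp only [map_mul] at h
        simp only [map_mul, FreeGroup.lift_apply_of]
        exact h
    | framing_comm i j =>
        have h := FramedBraidGroup.rel (.framing_comm i.castSucc j.castSucc)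
        simp only [map_mul] at h
        simp only [map_mul, FreeGroup.lift_apply_of]
        exact h
    | framing_braid i hi j =>
        have h := FramedBraidGroup.rel (.framing_braid i (Nat.lt_succ_of_lt hi) j.castSucc)
        rw [← strandSwap_castSucc i hi] at h
        simp only [map_mul] at h
        simp only [map_mul, FreeGroup.lift_apply_of]
        exact h)

/-- The algebraic sum `ε(α)` of the exponents of the `σ_i` in a framed braid `α`. -/
def FramedBraidGroup.exponent (n : ℕ) : FramedBraidGroup n →* Multiplicative ℤ :=
  FramedBraidGroup.lift
    (fun a => match a with
      | Gen.g _ _ => Multiplicative.ofAdd 1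
      | Gen.t _ => 1)
    (by intro a b h; cases h <;> simp [mul_comm])

/-! ### The representation of framed braids in `Y_{d,n}(u)` -/

section inverses

variable {d : ℕ} {u : ℂ} {n : ℕ}

lemma framingAverage_comm {A : Type*} [Ring A] [Algebra ℂ A] (a b : A)
    (hab : a * b = b * a) (ha : a ^ d = 1) (hb : b ^ d = 1) :
    framingAverage d a b = framingAverage d b a := by
  have hc : Commute a b := hab
  unfold framingAverage
  congr 1
  have h1 : ∑ s ∈ Finset.range d, b ^ s * a ^ (d - s)
      = ∑ s ∈ Finset.range d, a ^ (s + 1) * b ^ (d - (s + 1)) := by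
    rw [← Finset.sum_range_reflect]
    refine Finset.sum_congr rfl fun s hs => ?_
    have hs' : s < d := Finset.mem_range.mp hs
    rw [show d - 1 - s = d - (s + 1) by omega, show d - (d - (s + 1)) = s + 1 by omega]
    exact ((hc.pow_pow _ _).eq).symm
  have h2 := Finset.sum_range_succ (fun s => a ^ s * b ^ (d - s)) d
  have h3 := Finset.sum_range_succ' (fun s => a ^ s * b ^ (d - s)) d
  rw [h1]
  rw [h2] at h3
  simpa [ha, hb] using h3

lemma mul_framingAverage {A : Type*} [Ring A] [Algebra ℂ A] (a b : A)
    (hab : a * b = b * a) (ha : a ^ d = 1) (hb : b ^ d = 1) :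
    a * framingAverage d a b = b * framingAverage d a b := by
  have hc : Commute a b := hab
  unfold framingAverage
  rw [mul_smul_comm, mul_smul_comm]
  congr 1
  rw [Finset.mul_sum, Finset.mul_sum]
  have h2 := Finset.sum_range_succ (fun s => a ^ s * b ^ (d + 1 - s)) d
  have h3 := Finset.sum_range_succ' (fun s => a ^ s * b ^ (d + 1 - s)) d
  rw [h2] at h3
  have h4 : ∑ s ∈ Finset.range d, a * (a ^ s * b ^ (d - s))
      = ∑ s ∈ Finset.range d, a ^ (s + 1) * b ^ (d + 1 - (s + 1)) := by
    refine Finset.sum_congr rfl fun s _ => ?_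
    rw [← mul_assoc, ← pow_succ', Nat.add_sub_add_right]
  have h5 : ∑ s ∈ Finset.range d, b * (a ^ s * b ^ (d - s))
      = ∑ s ∈ Finset.range d, a ^ s * b ^ (d + 1 - s) := by
    refine Finset.sum_congr rfl fun s hs => ?_
    have hs' : s < d := Finset.mem_range.mp hs
    rw [← mul_assoc, ← (hc.pow_left s).eq, mul_assoc, ← pow_succ',
      show d - s + 1 = d + 1 - s by omega]
  rw [h4, h5]
  simpa [ha, hb, pow_succ] using h3.symm

lemma framingAverage_idem {A : Type*} [Ring A] [Algebra ℂ A] [NeZero d] (a b : A)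
    (hab : a * b = b * a) (ha : a ^ d = 1) (hb : b ^ d = 1) :
    framingAverage d a b * framingAverage d a b = framingAverage d a b := by
  have hc : Commute a b := hab
  have hm := mul_framingAverage a b hab ha hb
  have hp (s : ℕ) : a ^ s * framingAverage d a b = b ^ s * framingAverage d a b := by
    induction s with
    | zero => simp
    | succ k ih =>
        rw [pow_succ, mul_assoc, hm, ← mul_assoc, (hc.pow_left k).eq, mul_assoc, ih,
          ← mul_assoc, ← pow_succ']
  have key : ∀ s ∈ Finset.range d,
      a ^ s * b ^ (d - s) * framingAverage d a b = framingAverage d a b := by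
    intro s hs
    have hs' : s < d := Finset.mem_range.mp hs
    rw [(hc.pow_pow s (d - s)).eq, mul_assoc, hp, ← mul_assoc, ← pow_add,
      show d - s + s = d by omega, hb, one_mul]
  conv_lhs => enter [1]; unfold framingAverage
  rw [smul_mul_assoc, Finset.sum_mul, Finset.sum_congr rfl key, Finset.sum_const,
    Finset.card_range, ← Nat.cast_smul_eq_nsmul ℂ, smul_smul,
    inv_mul_cancel₀ (Nat.cast_ne_zero.mpr (NeZero.ne d)), one_smul]

lemma YH.e_idem [NeZero d] (i : ℕ) (hi : i + 1 < n) :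
    (YH.e i hi * YH.e i hi : YH d u n) = YH.e i hi :=
  framingAverage_idem _ _ (YH.framing_comm _ _) (YH.framing_pow _) (YH.framing_pow _)

lemma YH.e_comm_g (i : ℕ) (hi : i + 1 < n) :
    (YH.e i hi * YH.g i hi : YH d u n) = YH.g i hi * YH.e i hi := by
  have ht : SemiconjBy (YH.g i hi : YH d u n)
      (YH.t ⟨i + 1, hi⟩) (YH.t ⟨i, Nat.lt_of_succ_lt hi⟩) := by
    have h := YH.framing_braid (d := d) (u := u) i hi ⟨i, Nat.lt_of_succ_lt hi⟩
    rw [strandSwap, Equiv.swap_apply_left] at h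
    exact h.symm
  have ht' : SemiconjBy (YH.g i hi : YH d u n)
      (YH.t ⟨i, Nat.lt_of_succ_lt hi⟩) (YH.t ⟨i + 1, hi⟩) := by
    have h := YH.framing_braid (d := d) (u := u) i hi ⟨i + 1, hi⟩
    rw [strandSwap, Equiv.swap_apply_right] at h
    exact h.symm
  have h : (YH.e i hi * YH.g i hi : YH d u n)
      = YH.g i hi * framingAverage d (YH.t ⟨i + 1, hi⟩) (YH.t ⟨i, Nat.lt_of_succ_lt hi⟩) := by
    rw [YH.e, framingAverage, framingAverage, smul_mul_assoc, mul_smul_comm, Finset.sum_mul,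
      Finset.mul_sum]
    congr 1
    exact Finset.sum_congr rfl fun s _ =>
      (((ht.pow_right s).mul_right (ht'.pow_right (d - s))).eq).symm
  rw [h, framingAverage_comm _ _ (YH.framing_comm _ _) (YH.framing_pow _) (YH.framing_pow _)]
  rfl

/-- The inverse `g_i + (u⁻¹ - 1) e_i + (u⁻¹ - 1) e_i g_i` of `g_i`. -/
def YH.gInv (i : ℕ) (hi : i + 1 < n) : YH d u n :=
  YH.g i hi + (u⁻¹ - 1) • YH.e i hi + (u⁻¹ - 1) • (YH.e i hi * YH.g i hi)

lemma YH.gInv_comm (i : ℕ) (hi : i + 1 < n) :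
    (YH.gInv i hi * YH.g i hi : YH d u n) = YH.g i hi * YH.gInv i hi := by
  have h := YH.e_comm_g (d := d) (u := u) i hi
  simp only [YH.gInv, add_mul, mul_add, smul_mul_assoc, mul_smul_comm]
  rw [← mul_assoc, ← h]

lemma YH.g_mul_gInv [NeZero d] (hu : u ≠ 0) (i : ℕ) (hi : i + 1 < n) :
    (YH.g i hi * YH.gInv i hi : YH d u n) = 1 := by
  have h := YH.e_comm_g (d := d) (u := u) i hi
  have hq := YH.quadratic (d := d) (u := u) i hi
  have he := YH.e_idem (d := d) (u := u) i hi
  set g : YH d u n := YH.g i hi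
  set e : YH d u n := YH.e i hi
  have h1 : g * (e * g) = e + (u - 1) • e + (u - 1) • (e * g) := by
    rw [← mul_assoc, ← h, mul_assoc, ← sq, hq, mul_add, mul_add, mul_one, mul_smul_comm,
      mul_smul_comm, he, ← mul_assoc, he]
  have hg : (YH.gInv i hi : YH d u n) = g + (u⁻¹ - 1) • e + (u⁻¹ - 1) • (e * g) := rfl
  rw [hg, mul_add, mul_add, mul_smul_comm, mul_smul_comm, h1, ← h, ← sq, hq]
  have hu' : u * u⁻¹ = 1 := mul_inv_cancel₀ hu
  match_scalars
  · simp
  · linear_combination hu'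
  · linear_combination hu'

end inverses

/-- The images of the generators of `F_n`, as units of `Y_{d,n}(u)`. -/
def YH.unitGen {d : ℕ} [NeZero d] {u : ℂ} (hu : u ≠ 0) (n : ℕ) : Gen n → (YH d u n)ˣ
  | Gen.g i hi => ⟨YH.g i hi, YH.gInv i hi, YH.g_mul_gInv hu i hi,
      (YH.gInv_comm i hi).trans (YH.g_mul_gInv hu i hi)⟩
  | Gen.t j => Units.ofPowEqOne (YH.t j) d (YH.framing_pow j) (NeZero.ne d)

/-- The representation `γ : F_n → Y_{d,n}(u)`, `σ_i ↦ g_i`, `t_j ↦ t_j`. -/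
def gammaRep {d : ℕ} [NeZero d] {u : ℂ} (hu : u ≠ 0) (n : ℕ) :
    FramedBraidGroup n →* (YH d u n)ˣ :=
  FramedBraidGroup.lift (YH.unitGen hu n) (by
    intro a b h
    apply Units.ext
    cases h with
    | far i j hi hj hij => simpa [YH.unitGen] using YH.far i j hi hj hij
    | braid i hi hj => simpa [YH.unitGen] using YH.braid i hi hj
    | framing_comm i j => simpa [YH.unitGen] using YH.framing_comm i j
    | framing_braid i hi j => simpa [YH.unitGen] using YH.framing_braid i hi j)

/-! ### Framed links and the invariant `Γ_D` -/

/-- The elementary moves of framed braid equivalence on the framed braids with at least one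
strand: conjugation, and positive and negative stabilization. -/
inductive FramedMarkovMove :
    (Σ n : ℕ, FramedBraidGroup (n + 1)) → (Σ n : ℕ, FramedBraidGroup (n + 1)) → Prop
  | conj (n : ℕ) (α β : FramedBraidGroup (n + 1)) :
      FramedMarkovMove ⟨n, β * α * β⁻¹⟩ ⟨n, α⟩
  | stabPos (n : ℕ) (α : FramedBraidGroup (n + 1)) :
      FramedMarkovMove
        ⟨n + 1, FramedBraidGroup.incl (n + 1) α * FramedBraidGroup.σ n (Nat.lt_succ_self _)⟩
        ⟨n, α⟩
  | stabNeg (n : ℕ) (α : FramedBraidGroup (n + 1)) :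
      FramedMarkovMove
        ⟨n + 1, FramedBraidGroup.incl (n + 1) α * (FramedBraidGroup.σ n (Nat.lt_succ_self _))⁻¹⟩
        ⟨n, α⟩

/-- Oriented framed links up to isotopy, as closures of framed braids up to framed braid
equivalence (the equivalence relation generated by the moves). -/
def FramedLink : Type := Quot FramedMarkovMove

/-- The closure of a framed braid on `n + 1` strands. -/
def braidClosure {n : ℕ} (α : FramedBraidGroup (n + 1)) : FramedLink := Quot.mk _ ⟨n, α⟩

/-- `λ_D = (|D| z + 1 - u) / (|D| u z)`. -/
def lambdaD {d : ℕ} (u z : ℂ) (D : Finset (ZMod d)) : ℂ :=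
  (D.card * z + 1 - u) / (D.card * u * z)

/-- The value `P^{N-1} s^{ε(α)} tr(γ(α))`, `P = 1/(z s)`, on a framed braid `α` with `N = n + 1`
strands, where `s` is a chosen square root of `λ_D`. -/
def gammaValue {d : ℕ} [NeZero d] {u : ℂ} (hu : u ≠ 0) (z s : ℂ)
    (tr : ∀ n, YH d u n →ₗ[ℂ] ℂ) {n : ℕ} (α : FramedBraidGroup (n + 1)) : ℂ :=
  (1 / (z * s)) ^ n * s ^ (Multiplicative.toAdd (FramedBraidGroup.exponent (n + 1) α))
    * tr (n + 1) ((gammaRep hu (n + 1) α : (YH d u (n + 1))ˣ) : YH d u (n + 1))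

end

end FramizationTL

open FramizationTL

/-! A Juyumaya trace is determined by its values on the framing generators and its Markov property,
because `Y_{d,n+1}` is spanned by the elements `a t^m` and `a g b` with `a, b` in `Y_{d,n}` and `t`,
`g` the last generators. If the trace vanishes on the element `r`, its value on `r` times the
projection of three strands onto a residue `k` is a cubic in the Fourier coefficient `y_k` with
roots `0`, `-dz` and `-dz(u + 1)`. As `x` solves the E-system exactly when its Fourier transform is
constant on its support, it does so exactly when the two non-zero roots do not both occur.

For the converse, `Y_{d,n}` acts on functions on words of length `n` in two letters for each
residue. Equal residues interact by the `R`-matrix of the Hecke algebra on a two-dimensional space,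
so `r` acts as zero. The trace weighted by a product of letter weights then passes, and it is a
Juyumaya trace when the weights satisfy a Markov condition. In the E-system case the trace of
`a e_n` is a multiple of the trace of `a`, which makes negative stabilization work. -/

namespace FramizationTL

noncomputable section

/-! ### Generators and relations -/

section generators

variable {d : ℕ} {u : ℂ} {n : ℕ}

lemma YH.incl_g (i : ℕ) (hi : i + 1 < n) :
    YH.incl d u n (YH.g i hi) = YH.g i (Nat.lt_succ_of_lt hi) := by
  simp [YH.incl, YH.g, YH.mk, YH.inclGen]

lemma YH.incl_t (j : Fin n) : YH.incl d u n (YH.t j) = YH.t j.castSucc := by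
  simp [YH.incl, YH.t, YH.mk, YH.inclGen]

@[elab_as_elim]
lemma YH.induction {motive : YH d u n → Prop} (g : ∀ i hi, motive (YH.g i hi))
    (t : ∀ j, motive (YH.t j)) (algebraMap : ∀ r, motive (algebraMap ℂ (YH d u n) r))
    (mul : ∀ a b, motive a → motive b → motive (a * b))
    (add : ∀ a b, motive a → motive b → motive (a + b)) (a : YH d u n) : motive a := by
  obtain ⟨w, rfl⟩ := RingQuot.mkAlgHom_surjective ℂ (YHRel d u n) a
  induction w using FreeAlgebra.induction with
  | grade0 r => rw [AlgHom.commutes]; exact algebraMap r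
  | grade1 x =>
      cases x with
      | g i hi => exact g i hi
      | t j => exact t j
  | mul v w hv hw => rw [map_mul]; exact mul _ _ hv hw
  | add v w hv hw => rw [map_add]; exact add _ _ hv hw

lemma YH.commute_algHom {A : Type*} [Ring A] [Algebra ℂ A] (f : YH d u n →ₐ[ℂ] A) {b : A}
    (hg : ∀ i hi, Commute b (f (YH.g i hi))) (ht : ∀ j, Commute b (f (YH.t j)))
    (a : YH d u n) : Commute b (f a) := by
  induction a using YH.induction with
  | g i hi => exact hg i hi
  | t j => exact ht j
  | algebraMap r => rw [AlgHom.commutes]; exact (Algebra.commutes r b).symm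
  | mul a c ha hc => rw [map_mul]; exact ha.mul_right hc
  | add a c ha hc => rw [map_add]; exact ha.add_right hc

lemma YH.submodule_eq_top {W : Submodule ℂ (YH d u n)} (one : 1 ∈ W)
    (mul_g : ∀ i hi, ∀ a ∈ W, a * YH.g i hi ∈ W) (mul_t : ∀ j, ∀ a ∈ W, a * YH.t j ∈ W) :
    W = ⊤ := by
  have mul_mem (b : YH d u n) : ∀ a ∈ W, a * b ∈ W := by
    induction b using YH.induction with
    | g i hi => exact mul_g i hi
    | t j => exact mul_t j
    | algebraMap r =>
        intro a ha
        rw [← Algebra.commutes, ← Algebra.smul_def]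
        exact W.smul_mem r ha
    | mul b c hb hc => intro a ha; rw [← mul_assoc]; exact hc _ (hb a ha)
    | add b c hb hc => intro a ha; rw [mul_add]; exact W.add_mem (hb a ha) (hc a ha)
  exact eq_top_iff.mpr fun b _ => one_mul b ▸ mul_mem b 1 one

lemma YH.semiconjBy_g_t (i : ℕ) (hi : i + 1 < n) (j : Fin n) :
    SemiconjBy (YH.g i hi : YH d u n) (YH.t (strandSwap i hi j)) (YH.t j) :=
  (YH.framing_braid i hi j).symm

lemma YH.commute_g_t {i : ℕ} (hi : i + 1 < n) {j : Fin n} (hj : (j : ℕ) ≠ i)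
    (hj' : (j : ℕ) ≠ i + 1) : Commute (YH.g i hi : YH d u n) (YH.t j) := by
  have h := YH.semiconjBy_g_t (d := d) (u := u) i hi j
  rwa [strandSwap, Equiv.swap_apply_of_ne_of_ne (mt (congrArg Fin.val) hj)
    (mt (congrArg Fin.val) hj')] at h

lemma YH.semiconjBy_g_t_left (i : ℕ) (hi : i + 1 < n) :
    SemiconjBy (YH.g i hi : YH d u n) (YH.t ⟨i + 1, hi⟩) (YH.t ⟨i, Nat.lt_of_succ_lt hi⟩) := by
  have h := YH.semiconjBy_g_t (d := d) (u := u) i hi ⟨i, Nat.lt_of_succ_lt hi⟩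
  rwa [strandSwap, Equiv.swap_apply_left] at h

lemma YH.semiconjBy_g_t_right (i : ℕ) (hi : i + 1 < n) :
    SemiconjBy (YH.g i hi : YH d u n) (YH.t ⟨i, Nat.lt_of_succ_lt hi⟩) (YH.t ⟨i + 1, hi⟩) := by
  have h := YH.semiconjBy_g_t (d := d) (u := u) i hi ⟨i + 1, hi⟩
  rwa [strandSwap, Equiv.swap_apply_right] at h

end generators

section lastStrand

variable {d : ℕ} {u : ℂ}

/-- The braiding generator that crosses the last two strands. -/
abbrev YH.gLast (n : ℕ) : YH d u (n + 2) := YH.g n (Nat.lt_succ_self _)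

/-- The element `e_i` of the last two strands. -/
abbrev YH.eLast (n : ℕ) : YH d u (n + 2) := YH.e n (Nat.lt_succ_self _)

lemma YH.semiconjBy_gLast_t_last (n : ℕ) :
    SemiconjBy (YH.gLast n : YH d u (n + 2)) (YH.t (Fin.last (n + 1)))
      (YH.t (Fin.last n).castSucc) :=
  YH.semiconjBy_g_t_left n _

lemma YH.semiconjBy_gLast_t_castSucc_last (n : ℕ) :
    SemiconjBy (YH.gLast n : YH d u (n + 2)) (YH.t (Fin.last n).castSucc)
      (YH.t (Fin.last (n + 1))) :=
  YH.semiconjBy_g_t_right n _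

lemma YH.eLast_eq (n : ℕ) : (YH.eLast n : YH d u (n + 2))
    = framingAverage d (YH.t (Fin.last n).castSucc) (YH.t (Fin.last (n + 1))) :=
  rfl

lemma YH.commute_t_last_incl {n : ℕ} (a : YH d u n) :
    Commute (YH.t (Fin.last n) : YH d u (n + 1)) (YH.incl d u n a) :=
  YH.commute_algHom _
    (fun i hi => YH.incl_g (d := d) (u := u) i hi ▸
      (YH.commute_g_t _ (by simp; omega) (by simp; omega)).symm)
    (fun j => YH.incl_t (d := d) (u := u) j ▸ YH.framing_comm _ _) a

lemma YH.commute_gLast_incl_incl {n : ℕ} (a : YH d u n) :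
    Commute (YH.gLast n : YH d u (n + 2)) (YH.incl d u (n + 1) (YH.incl d u n a)) := by
  refine YH.commute_algHom ((YH.incl d u (n + 1)).comp (YH.incl d u n)) (fun i hi => ?_)
    (fun j => ?_) a
  · rw [AlgHom.comp_apply, YH.incl_g, YH.incl_g]
    exact (YH.far i n _ _ hi).symm
  · rw [AlgHom.comp_apply, YH.incl_t, YH.incl_t]
    exact YH.commute_g_t _ (by simp; omega) (by simp; omega)

end lastStrand

/-! ### Uniqueness of the trace -/

section uniqueness

variable {d : ℕ} {u : ℂ}

/-- The elements `a t^m` of the inductive spanning set, where `t` is the last framing generator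
and `a` does not involve the last strand. -/
def framingWords (d : ℕ) (u : ℂ) (n : ℕ) : Set (YH d u (n + 1)) :=
  {x | ∃ a m, x = YH.incl d u n a * YH.t (Fin.last n) ^ m}

/-- The elements `a g b` of the inductive spanning set, where `g` is the last braiding generator
and `a`, `b` do not involve the last strand. -/
def braidingWords (d : ℕ) (u : ℂ) (n : ℕ) : Set (YH d u (n + 2)) :=
  {x | ∃ a b, x = YH.incl d u (n + 1) a * YH.gLast n * YH.incl d u (n + 1) b}

/-- The span of the inductive spanning set; by `wordSpan_eq_top` it is the whole algebra. -/
def wordSpan (d : ℕ) (u : ℂ) (n : ℕ) : Submodule ℂ (YH d u (n + 2)) :=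
  Submodule.span ℂ (framingWords d u (n + 1) ∪ braidingWords d u n)

lemma framingWord_mem_wordSpan {n : ℕ} (a : YH d u (n + 1)) (m : ℕ) :
    YH.incl d u (n + 1) a * YH.t (Fin.last (n + 1)) ^ m ∈ wordSpan d u n :=
  Submodule.subset_span (Or.inl ⟨a, m, rfl⟩)

lemma braidingWord_mem_wordSpan {n : ℕ} (a b : YH d u (n + 1)) :
    YH.incl d u (n + 1) a * YH.gLast n * YH.incl d u (n + 1) b ∈ wordSpan d u n :=
  Submodule.subset_span (Or.inr ⟨a, b, rfl⟩)

lemma map_mem_of_mem_wordSpan {M : Type*} [AddCommGroup M] [Module ℂ M] {N : Submodule ℂ M}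
    {n : ℕ} (f : YH d u (n + 2) →ₗ[ℂ] M)
    (framing : ∀ a m, f (YH.incl d u (n + 1) a * YH.t (Fin.last (n + 1)) ^ m) ∈ N)
    (braiding : ∀ a b, f (YH.incl d u (n + 1) a * YH.gLast n * YH.incl d u (n + 1) b) ∈ N)
    {x : YH d u (n + 2)} (hx : x ∈ wordSpan d u n) : f x ∈ N := by
  refine Submodule.span_le (p := N.comap f).mpr ?_ hx
  rintro _ (⟨a, m, rfl⟩ | ⟨a, b, rfl⟩)
  exacts [framing a m, braiding a b]

variable {n : ℕ} {x : YH d u (n + 2)}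

lemma mul_incl_mem_wordSpan (hx : x ∈ wordSpan d u n) (c : YH d u (n + 1)) :
    x * YH.incl d u (n + 1) c ∈ wordSpan d u n := by
  refine map_mem_of_mem_wordSpan (LinearMap.mulRight ℂ _) (fun a m => ?_) (fun a b => ?_) hx
  · rw [LinearMap.mulRight_apply, mul_assoc, ((YH.commute_t_last_incl c).pow_left m).eq,
      ← mul_assoc, ← map_mul]
    exact framingWord_mem_wordSpan _ m
  · rw [LinearMap.mulRight_apply, mul_assoc, ← map_mul]
    exact braidingWord_mem_wordSpan _ _

lemma incl_mul_mem_wordSpan (hx : x ∈ wordSpan d u n) (c : YH d u (n + 1)) :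
    YH.incl d u (n + 1) c * x ∈ wordSpan d u n := by
  refine map_mem_of_mem_wordSpan (LinearMap.mulLeft ℂ _) (fun a m => ?_) (fun a b => ?_) hx
  · rw [LinearMap.mulLeft_apply, ← mul_assoc, ← map_mul]
    exact framingWord_mem_wordSpan _ m
  · rw [LinearMap.mulLeft_apply, ← mul_assoc, ← mul_assoc, ← map_mul]
    exact braidingWord_mem_wordSpan _ _

lemma mul_t_last_pow_mem_wordSpan (hx : x ∈ wordSpan d u n) (m : ℕ) :
    x * YH.t (Fin.last (n + 1)) ^ m ∈ wordSpan d u n := by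
  refine map_mem_of_mem_wordSpan (LinearMap.mulRight ℂ _) (fun a k => ?_) (fun a b => ?_) hx
  · rw [LinearMap.mulRight_apply, mul_assoc, ← pow_add]
    exact framingWord_mem_wordSpan a _
  · rw [LinearMap.mulRight_apply, mul_assoc, ← ((YH.commute_t_last_incl b).pow_left m).eq,
      ← mul_assoc, mul_assoc (YH.incl d u (n + 1) a),
      ((YH.semiconjBy_gLast_t_last n).pow_right m).eq, ← YH.incl_t, ← map_pow, ← mul_assoc,
      ← map_mul]
    exact braidingWord_mem_wordSpan _ _

lemma one_mem_wordSpan : (1 : YH d u (n + 2)) ∈ wordSpan d u n := by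
  simpa using framingWord_mem_wordSpan (1 : YH d u (n + 1)) 0

lemma gLast_mem_wordSpan : (YH.gLast n : YH d u (n + 2)) ∈ wordSpan d u n := by
  simpa using braidingWord_mem_wordSpan (1 : YH d u (n + 1)) 1

lemma t_last_pow_mul_gLast_mem_wordSpan (m : ℕ) :
    (YH.t (Fin.last (n + 1)) ^ m * YH.gLast n : YH d u (n + 2)) ∈ wordSpan d u n := by
  rw [← ((YH.semiconjBy_gLast_t_castSucc_last n).pow_right m).eq, ← YH.incl_t, ← map_pow]
  exact mul_incl_mem_wordSpan gLast_mem_wordSpan _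

lemma eLast_mem_wordSpan : (YH.eLast n : YH d u (n + 2)) ∈ wordSpan d u n := by
  rw [YH.eLast_eq, framingAverage, ← YH.incl_t]
  refine Submodule.smul_mem _ _ (Submodule.sum_mem _ fun s _ => ?_)
  rw [← map_pow]
  exact framingWord_mem_wordSpan _ _

lemma eLast_mul_gLast_mem_wordSpan :
    (YH.eLast n * YH.gLast n : YH d u (n + 2)) ∈ wordSpan d u n := by
  rw [YH.eLast_eq, framingAverage, ← YH.incl_t, smul_mul_assoc, Finset.sum_mul]
  refine Submodule.smul_mem _ _ (Submodule.sum_mem _ fun s _ => ?_)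
  rw [← map_pow, mul_assoc]
  exact incl_mul_mem_wordSpan (t_last_pow_mul_gLast_mem_wordSpan _) _

lemma gLast_sq_mem_wordSpan : (YH.gLast n ^ 2 : YH d u (n + 2)) ∈ wordSpan d u n := by
  rw [YH.quadratic]
  exact Submodule.add_mem _
    (Submodule.add_mem _ one_mem_wordSpan (Submodule.smul_mem _ _ eLast_mem_wordSpan))
    (Submodule.smul_mem _ _ eLast_mul_gLast_mem_wordSpan)

lemma gLast_mul_framingWord_mul_gLast_mem_wordSpan (a : YH d u n) (m : ℕ) :
    YH.gLast n * YH.incl d u (n + 1) (YH.incl d u n a * YH.t (Fin.last n) ^ m) * YH.gLast n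
      ∈ wordSpan d u n := by
  rw [map_mul, map_pow, YH.incl_t, ← mul_assoc, (YH.commute_gLast_incl_incl a).eq, mul_assoc,
    mul_assoc, ← ((YH.semiconjBy_gLast_t_last n).pow_right m).eq, ← mul_assoc (YH.gLast n), ← sq]
  exact incl_mul_mem_wordSpan (mul_t_last_pow_mem_wordSpan gLast_sq_mem_wordSpan m) _

lemma gLast_mul_braidingWord_mul_gLast_mem_wordSpan (a b : YH d u (n + 1)) :
    YH.gLast (n + 1) * YH.incl d u (n + 2)
        (YH.incl d u (n + 1) a * YH.gLast n * YH.incl d u (n + 1) b) * YH.gLast (n + 1)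
      ∈ wordSpan d u (n + 1) := by
  have hb := (YH.commute_gLast_incl_incl b).eq
  set G : YH d u (n + 3) := YH.gLast (n + 1)
  set H := YH.incl d u (n + 2) (YH.gLast n) with hH
  set A := YH.incl d u (n + 2) (YH.incl d u (n + 1) a) with hA
  set B := YH.incl d u (n + 2) (YH.incl d u (n + 1) b)
  have braid : G * H * G = H * G * H := by
    rw [hH, YH.incl_g]
    exact (YH.braid n _ _).symm
  have pull : G * (A * H * B) * G = A * H * G * (H * B) :=
    calc G * (A * H * B) * G = (G * A) * H * (B * G) := by simp only [mul_assoc]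
      _ = A * (G * H * G) * B := by
        rw [← hb, hA, (YH.commute_gLast_incl_incl a).eq]; simp only [mul_assoc]; rfl
      _ = A * H * G * (H * B) := by rw [braid]; simp only [mul_assoc]
  rw [map_mul, map_mul, pull, ← map_mul, ← map_mul]
  exact braidingWord_mem_wordSpan _ _

lemma wordSpan_eq_top_of_gLast_mul_incl_mul_gLast_mem
    (h : ∀ b, YH.gLast n * YH.incl d u (n + 1) b * YH.gLast n ∈ wordSpan d u n) :
    wordSpan d u n = ⊤ := by
  refine YH.submodule_eq_top one_mem_wordSpan (fun i hi x hx => ?_) fun j x hx => ?_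
  · rcases Nat.lt_succ_iff_lt_or_eq.mp hi with hlt | heq
    · rw [← YH.incl_g i hlt]
      exact mul_incl_mem_wordSpan hx _
    · obtain rfl : i = n := by omega
      refine map_mem_of_mem_wordSpan (LinearMap.mulRight ℂ _) (fun a m => ?_) (fun a b => ?_) hx
      · rw [LinearMap.mulRight_apply, mul_assoc]
        exact incl_mul_mem_wordSpan (t_last_pow_mul_gLast_mem_wordSpan m) a
      · rw [LinearMap.mulRight_apply, mul_assoc, mul_assoc, ← mul_assoc (YH.gLast i)]
        exact incl_mul_mem_wordSpan (h b) a
  · induction j using Fin.lastCases with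
    | last => simpa using mul_t_last_pow_mem_wordSpan hx 1
    | cast j => rw [← YH.incl_t]; exact mul_incl_mem_wordSpan hx _

lemma span_framingWords_zero : Submodule.span ℂ (framingWords d u 0) = ⊤ := by
  refine YH.submodule_eq_top (Submodule.subset_span ⟨1, 0, by simp⟩)
    (fun i hi => absurd hi (by omega)) fun j x hx => ?_
  obtain rfl : j = Fin.last 0 := Fin.eq_zero j
  refine Submodule.span_le
    (p := (Submodule.span ℂ (framingWords d u 0)).comap (LinearMap.mulRight ℂ _)).mpr ?_ hx
  rintro _ ⟨a, m, rfl⟩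
  exact Submodule.subset_span ⟨a, m + 1, by rw [LinearMap.mulRight_apply, pow_succ, mul_assoc]⟩

lemma wordSpan_eq_top (n : ℕ) : wordSpan d u n = ⊤ := by
  let sandwich (n : ℕ) : YH d u (n + 1) →ₗ[ℂ] YH d u (n + 2) :=
    LinearMap.mulLeftRight ℂ (YH.gLast n, YH.gLast n) ∘ₗ (YH.incl d u (n + 1)).toLinearMap
  induction n with
  | zero =>
      refine wordSpan_eq_top_of_gLast_mul_incl_mul_gLast_mem fun b => ?_
      refine Submodule.span_le (p := (wordSpan d u 0).comap (sandwich 0)).mpr ?_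
        (span_framingWords_zero ▸ Submodule.mem_top : b ∈ Submodule.span ℂ (framingWords d u 0))
      rintro _ ⟨a, m, rfl⟩
      exact gLast_mul_framingWord_mul_gLast_mem_wordSpan a m
  | succ n ih =>
      refine wordSpan_eq_top_of_gLast_mul_incl_mul_gLast_mem fun b => ?_
      exact map_mem_of_mem_wordSpan (sandwich (n + 1))
        gLast_mul_framingWord_mul_gLast_mem_wordSpan
        gLast_mul_braidingWord_mul_gLast_mem_wordSpan (ih ▸ Submodule.mem_top : b ∈ wordSpan d u n)

lemma YH.linearMap_ext_zero {M : Type*} [AddCommGroup M] [Module ℂ M] {f g : YH d u 0 →ₗ[ℂ] M}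
    (h : f 1 = g 1) : f = g := by
  have htop : LinearMap.eqLocus f g = ⊤ :=
    YH.submodule_eq_top h (fun i hi => absurd hi (by omega)) fun j => j.elim0
  exact LinearMap.ext fun a => (htop ▸ Submodule.mem_top : a ∈ LinearMap.eqLocus f g)

end uniqueness

section trace

variable {d : ℕ} [NeZero d] {u z : ℂ} {x : ZMod d → ℂ} {tr tr' : ∀ n, YH d u n →ₗ[ℂ] ℂ}

lemma IsJuyumayaTrace.incl_mul_t_last_pow (h : IsJuyumayaTrace d u z x tr) (hx : x 0 = 1)
    {n : ℕ} (a : YH d u n) (m : ℕ) :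
    tr (n + 1) (YH.incl d u n a * YH.t (Fin.last n) ^ m) = x (m : ZMod d) * tr n a := by
  rw [pow_eq_pow_mod m (YH.framing_pow (Fin.last n)), ← ZMod.natCast_mod m d]
  rcases Nat.eq_zero_or_pos (m % d) with hm | hm
  · rw [hm, pow_zero, mul_one, h.compatible, Nat.cast_zero, hx, one_mul]
  · exact h.framing n a _ hm (Nat.mod_lt _ (NeZero.pos d))

theorem IsJuyumayaTrace.unique (hx : x 0 = 1) (h : IsJuyumayaTrace d u z x tr)
    (h' : IsJuyumayaTrace d u z x tr') : tr = tr' := by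
  funext n
  have eqOn_framingWords (n : ℕ) (hn : tr n = tr' n) :
      Set.EqOn (tr (n + 1)) (tr' (n + 1)) (framingWords d u n) := by
    rintro _ ⟨a, m, rfl⟩
    rw [h.incl_mul_t_last_pow hx, h'.incl_mul_t_last_pow hx, hn]
  induction n with
  | zero => exact YH.linearMap_ext_zero (by rw [h.one, h'.one])
  | succ n ih =>
      cases n with
      | zero => exact LinearMap.ext_on span_framingWords_zero (eqOn_framingWords 0 ih)
      | succ n =>
          refine LinearMap.ext_on (wordSpan_eq_top n) ?_
          rintro b (hb | ⟨a, c, rfl⟩)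
          · exact eqOn_framingWords (n + 1) ih hb
          · rw [h.mul_comm, h'.mul_comm, ← mul_assoc, ← map_mul, h.braiding, h'.braiding, ih]

end trace

/-! ### Characters and eigenprojections -/

section characters

variable {d : ℕ} [NeZero d]

lemma stdAddChar_pow (k : ZMod d) (m : ℕ) :
    (ZMod.stdAddChar k : ℂ) ^ m = ZMod.stdAddChar (k * (m : ZMod d)) := by
  rw [mul_comm, ← nsmul_eq_mul, AddChar.map_nsmul_eq_pow]

lemma stdAddChar_pow_eq_one (k : ZMod d) : (ZMod.stdAddChar k : ℂ) ^ d = 1 := by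
  simp [stdAddChar_pow]

lemma sum_stdAddChar_mul (k : ZMod d) :
    ∑ s : ZMod d, ZMod.stdAddChar (k * s) = if k = 0 then (d : ℂ) else 0 := by
  split_ifs with h
  · simp [h, ZMod.card]
  · exact AddChar.sum_eq_zero_of_ne_one (ZMod.isPrimitive_stdAddChar d h)

lemma sum_range_natCast_zmod {M : Type*} [AddCommMonoid M] (f : ZMod d → M) :
    ∑ s ∈ Finset.range d, f s = ∑ s : ZMod d, f s :=
  Finset.sum_nbij' (fun s => (s : ZMod d)) ZMod.val (by simp) (by simp [ZMod.val_lt])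
    (fun s hs => ZMod.val_cast_of_lt (Finset.mem_range.mp hs)) (by simp) (by simp)

end characters

section eigenProj

variable {A B : Type*} [Ring A] [Algebra ℂ A] [Ring B] [Algebra ℂ B] {d : ℕ} {ζ : ℂ} {a b g : A}

/-- For `a ^ d = 1` and `ζ ^ d = 1`, the projection onto the eigenspace of `a` for `ζ`, as a
polynomial in `a`. -/
def eigenProj (d : ℕ) (ζ : ℂ) (a : A) : A :=
  (d : ℂ)⁻¹ • ∑ s ∈ Finset.range d, (ζ⁻¹ • a) ^ s

lemma map_eigenProj (f : A →ₐ[ℂ] B) : f (eigenProj d ζ a) = eigenProj d ζ (f a) := by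
  simp only [eigenProj, map_smul, map_sum, map_pow]

lemma semiconjBy_eigenProj (h : SemiconjBy g a b) :
    SemiconjBy g (eigenProj d ζ a) (eigenProj d ζ b) := by
  have hpow (s : ℕ) : g * (ζ⁻¹ • a) ^ s = (ζ⁻¹ • b) ^ s * g :=
    SemiconjBy.pow_right (by rw [SemiconjBy, mul_smul_comm, smul_mul_assoc, h.eq]) s
  simp only [SemiconjBy, eigenProj, mul_smul_comm, smul_mul_assoc, Finset.mul_sum, Finset.sum_mul,
    hpow]

lemma commute_eigenProj (h : Commute g a) : Commute g (eigenProj d ζ a) :=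
  semiconjBy_eigenProj h

lemma inv_smul_mul_eigenProj (hζ : ζ ^ d = 1) (ha : a ^ d = 1) :
    (ζ⁻¹ • a) * eigenProj d ζ a = eigenProj d ζ a := by
  have h := mul_geom_sum (ζ⁻¹ • a) d
  rw [smul_pow, inv_pow, hζ, ha, inv_one, one_smul, sub_self, sub_mul, one_mul, sub_eq_zero] at h
  rw [eigenProj, mul_smul_comm, h]

variable [NeZero d]

lemma pow_mul_eigenProj (hζ : ζ ^ d = 1) (ha : a ^ d = 1) (m : ℕ) :
    a ^ m * eigenProj d ζ a = ζ ^ m • eigenProj d ζ a := by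
  have hζ0 : ζ ≠ 0 := (IsUnit.of_pow_eq_one hζ (NeZero.ne d)).ne_zero
  induction m with
  | zero => simp
  | succ m ih =>
      have h := inv_smul_mul_eigenProj hζ ha
      rw [smul_mul_assoc, inv_smul_eq_iff₀ hζ0] at h
      rw [pow_succ, mul_assoc, h, mul_smul_comm, ih, smul_smul, pow_succ']

lemma eigenProj_mul_self (hζ : ζ ^ d = 1) (ha : a ^ d = 1) :
    eigenProj d ζ a * eigenProj d ζ a = eigenProj d ζ a := by
  have hpow (s : ℕ) : (ζ⁻¹ • a) ^ s * eigenProj d ζ a = eigenProj d ζ a := by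
    induction s with
    | zero => simp
    | succ s ih => rw [pow_succ, mul_assoc, inv_smul_mul_eigenProj hζ ha, ih]
  conv_lhs => enter [1]; rw [eigenProj]
  rw [smul_mul_assoc, Finset.sum_mul, Finset.sum_congr rfl fun s _ => hpow s, Finset.sum_const,
    Finset.card_range, ← Nat.cast_smul_eq_nsmul ℂ, inv_smul_smul₀ (NeZero.ne _)]

lemma framingAverage_mul_eigenProj_mul_eigenProj (hζ : ζ ^ d = 1) (ha : a ^ d = 1)
    (hb : b ^ d = 1) (hab : Commute a b) :
    framingAverage d a b * (eigenProj d ζ a * eigenProj d ζ b)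
      = eigenProj d ζ a * eigenProj d ζ b := by
  have hterm : ∀ s ∈ Finset.range d, a ^ s * b ^ (d - s) * (eigenProj d ζ a * eigenProj d ζ b)
      = eigenProj d ζ a * eigenProj d ζ b := by
    intro s hs
    rw [((commute_eigenProj hab.symm).pow_left _).mul_mul_mul_comm, pow_mul_eigenProj hζ ha,
      pow_mul_eigenProj hζ hb, smul_mul_smul_comm, ← pow_add,
      Nat.add_sub_of_le (Finset.mem_range.mp hs).le, hζ, one_smul]
  conv_lhs => enter [1]; rw [framingAverage]
  rw [smul_mul_assoc, Finset.sum_mul, Finset.sum_congr rfl hterm, Finset.sum_const,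
    Finset.card_range, ← Nat.cast_smul_eq_nsmul ℂ, inv_smul_smul₀ (NeZero.ne _)]

end eigenProj

/-! ### Necessary conditions: the trace of the eigenprojections -/

section proj

variable {d : ℕ} [NeZero d] {u : ℂ} {n : ℕ} (k : ZMod d)

/-- The idempotent of `Y_{d,n}(u)` that projects onto the part on which `t_j` acts as
`exp(2πik/d)`. -/
def YH.proj (j : Fin n) : YH d u n := eigenProj d (ZMod.stdAddChar k) (YH.t j)

lemma YH.incl_proj (j : Fin n) :
    YH.incl d u n (YH.proj k j) = YH.proj k j.castSucc := by
  rw [YH.proj, map_eigenProj, YH.incl_t, YH.proj]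

lemma YH.t_pow_mul_proj (j : Fin n) (m : ℕ) :
    (YH.t j ^ m * YH.proj k j : YH d u n) = (ZMod.stdAddChar k : ℂ) ^ m • YH.proj k j :=
  pow_mul_eigenProj (stdAddChar_pow_eq_one k) (YH.framing_pow j) m

lemma YH.proj_mul_self (j : Fin n) : (YH.proj k j * YH.proj k j : YH d u n) = YH.proj k j :=
  eigenProj_mul_self (stdAddChar_pow_eq_one k) (YH.framing_pow j)

lemma YH.commute_t_proj (i j : Fin n) : Commute (YH.t i : YH d u n) (YH.proj k j) :=
  commute_eigenProj (YH.framing_comm i j)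

lemma YH.commute_proj_proj (i j : Fin n) : Commute (YH.proj k i : YH d u n) (YH.proj k j) :=
  commute_eigenProj (YH.commute_t_proj k j i).symm

lemma YH.commute_proj_last_incl (a : YH d u n) :
    Commute (YH.proj k (Fin.last n)) (YH.incl d u n a) :=
  (commute_eigenProj (YH.commute_t_last_incl a).symm).symm

lemma YH.semiconjBy_gLast_proj_castSucc_last (n : ℕ) :
    SemiconjBy (YH.gLast n : YH d u (n + 2)) (YH.proj k (Fin.last n).castSucc)
      (YH.proj k (Fin.last (n + 1))) :=
  semiconjBy_eigenProj (YH.semiconjBy_gLast_t_castSucc_last n)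

lemma YH.semiconjBy_gLast_proj_last (n : ℕ) :
    SemiconjBy (YH.gLast n : YH d u (n + 2)) (YH.proj k (Fin.last (n + 1)))
      (YH.proj k (Fin.last n).castSucc) :=
  semiconjBy_eigenProj (YH.semiconjBy_gLast_t_last n)

/-- The idempotent that projects the last two strands onto the residue `k`. -/
def YH.projLastTwo (n : ℕ) : YH d u (n + 2) :=
  YH.proj k (Fin.last n).castSucc * YH.proj k (Fin.last (n + 1))

lemma YH.commute_gLast_projLastTwo (n : ℕ) :
    Commute (YH.gLast n : YH d u (n + 2)) (YH.projLastTwo k n) := by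
  have swap : SemiconjBy (YH.gLast n : YH d u (n + 2)) (YH.projLastTwo k n)
      (YH.proj k (Fin.last (n + 1)) * YH.proj k (Fin.last n).castSucc) :=
    (YH.semiconjBy_gLast_proj_castSucc_last k n).mul_right (YH.semiconjBy_gLast_proj_last k n)
  rwa [(YH.commute_proj_proj k _ _).eq] at swap

lemma YH.eLast_mul_projLastTwo (n : ℕ) :
    (YH.eLast n * YH.projLastTwo k n : YH d u (n + 2)) = YH.projLastTwo k n :=
  framingAverage_mul_eigenProj_mul_eigenProj (stdAddChar_pow_eq_one k) (YH.framing_pow _)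
    (YH.framing_pow _) (YH.framing_comm _ _)

lemma YH.proj_last_mul_projLastTwo (n : ℕ) :
    (YH.proj k (Fin.last (n + 1)) * YH.projLastTwo k n : YH d u (n + 2))
      = YH.projLastTwo k n := by
  rw [YH.projLastTwo, (YH.commute_proj_proj k _ _).eq, ← mul_assoc, YH.proj_mul_self]

lemma YH.projLastTwo_mul_one_add_gLast_sq (n : ℕ) :
    (YH.projLastTwo k n * (1 + YH.gLast n) ^ 2 : YH d u (n + 2))
      = (u + 1) • (YH.projLastTwo k n * (1 + YH.gLast n)) := by
  have hg := (YH.commute_gLast_projLastTwo (u := u) k n).eq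
  have he := YH.eLast_mul_projLastTwo (u := u) k n
  have hsq : (YH.projLastTwo k n * YH.gLast n ^ 2 : YH d u (n + 2))
      = u • YH.projLastTwo k n + (u - 1) • (YH.projLastTwo k n * YH.gLast n) := by
    rw [← ((YH.commute_gLast_projLastTwo k n).pow_left 2).eq, YH.quadratic, add_mul, add_mul,
      one_mul, smul_mul_assoc, smul_mul_assoc, YH.e_comm_g, mul_assoc, he, hg]
    module
  have expand : (1 + YH.gLast n : YH d u (n + 2)) ^ 2 = 1 + 2 • YH.gLast n + YH.gLast n ^ 2 := by
    noncomm_ring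
  rw [expand, mul_add, mul_add, hsq, mul_one, mul_smul_comm, mul_add, mul_one]
  module

end proj

section necessary

lemma YH.steinberg_eq {d : ℕ} {u : ℂ} (n : ℕ) :
    (YH.steinberg n (Nat.lt_succ_self _) : YH d u (n + 3))
      = YH.incl d u (n + 2) (1 + YH.gLast n) * YH.gLast (n + 1)
        * YH.incl d u (n + 2) (1 + YH.gLast n) + YH.incl d u (n + 2) (1 + YH.gLast n) := by
  rw [map_add, map_one, YH.incl_g, YH.steinberg]
  noncomm_ring

variable {d : ℕ} [NeZero d] {u z : ℂ} {x : ZMod d → ℂ} {tr : ∀ n, YH d u n →ₗ[ℂ] ℂ}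
  {n : ℕ} (k : ZMod d)

lemma IsJuyumayaTrace.incl_mul_proj_last (h : IsJuyumayaTrace d u z x tr) (hx : x 0 = 1)
    (a : YH d u n) :
    tr (n + 1) (YH.incl d u n a * YH.proj k (Fin.last n)) = ZMod.dft x k / d * tr n a := by
  have hterm (s : ℕ) : tr (n + 1) (YH.incl d u n a
      * ((ZMod.stdAddChar k : ℂ)⁻¹ • YH.t (Fin.last n)) ^ s)
      = ZMod.stdAddChar (-((s : ZMod d) * k)) * x s * tr n a := by
    rw [smul_pow, mul_smul_comm, map_smul, h.incl_mul_t_last_pow hx, smul_eq_mul,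
      ← AddChar.map_neg_eq_inv, stdAddChar_pow, ← mul_assoc, neg_mul, _root_.mul_comm k]
  rw [YH.proj, eigenProj, mul_smul_comm, map_smul, Finset.mul_sum, map_sum,
    Finset.sum_congr rfl fun s _ => hterm s, ← Finset.sum_mul,
    sum_range_natCast_zmod fun s => ZMod.stdAddChar (-(s * k)) * x s, ZMod.dft_apply]
  simp only [smul_eq_mul]
  ring

lemma IsJuyumayaTrace.proj_last (h : IsJuyumayaTrace d u z x tr) (hx : x 0 = 1) :
    tr (n + 1) (YH.proj k (Fin.last n)) = ZMod.dft x k / d := by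
  simpa [h.one] using h.incl_mul_proj_last k hx (1 : YH d u n)

lemma IsJuyumayaTrace.projLastTwo (h : IsJuyumayaTrace d u z x tr) (hx : x 0 = 1) :
    tr (n + 2) (YH.projLastTwo k n) = (ZMod.dft x k / d) ^ 2 := by
  rw [YH.projLastTwo, ← YH.incl_proj, h.incl_mul_proj_last k hx, h.proj_last k hx, sq]

lemma IsJuyumayaTrace.projLastTwo_mul_gLast (h : IsJuyumayaTrace d u z x tr) (hx : x 0 = 1) :
    tr (n + 2) (YH.projLastTwo k n * YH.gLast n) = z * (ZMod.dft x k / d) := by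
  rw [YH.projLastTwo, mul_assoc, ← (YH.semiconjBy_gLast_proj_castSucc_last k n).eq, h.mul_comm,
    mul_assoc, YH.proj_mul_self, h.mul_comm, ← YH.incl_proj, h.braiding, h.proj_last k hx]

lemma IsJuyumayaTrace.incl_mul_proj_last_mul_steinberg (h : IsJuyumayaTrace d u z x tr)
    (hx : x 0 = 1) (p : YH d u (n + 2)) :
    tr (n + 3) (YH.incl d u (n + 2) p * YH.proj k (Fin.last (n + 2))
        * YH.steinberg n (Nat.lt_succ_self _))
      = z * tr (n + 2) (YH.proj k (Fin.last (n + 1)) * (1 + YH.gLast n) * p * (1 + YH.gLast n))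
        + ZMod.dft x k / d * tr (n + 2) (p * (1 + YH.gLast n)) := by
  set b : YH d u (n + 2) := 1 + YH.gLast n
  have hcomm := (YH.commute_proj_last_incl k b).eq
  have hbraid : tr (n + 3) (YH.incl d u (n + 2) p * YH.proj k (Fin.last (n + 2))
      * (YH.incl d u (n + 2) b * YH.gLast (n + 1) * YH.incl d u (n + 2) b))
      = z * tr (n + 2) (YH.proj k (Fin.last (n + 1)) * b * p * b) := by
    calc _ = tr (n + 3) (YH.incl d u (n + 2) (b * p * b)
          * (YH.proj k (Fin.last (n + 2)) * YH.gLast (n + 1))) := by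
          rw [← mul_assoc, h.mul_comm]
          simp only [map_mul, mul_assoc]
          rw [← mul_assoc (YH.proj k _) (YH.incl _ _ _ b), hcomm, mul_assoc]
      _ = _ := by
          rw [← (YH.semiconjBy_gLast_proj_castSucc_last k (n + 1)).eq, ← mul_assoc, h.mul_comm,
            ← mul_assoc, ← YH.incl_proj, ← map_mul, h.braiding]
          simp only [mul_assoc]
  have hframing : tr (n + 3) (YH.incl d u (n + 2) p * YH.proj k (Fin.last (n + 2))
      * YH.incl d u (n + 2) b) = ZMod.dft x k / d * tr (n + 2) (p * b) := by
    rw [mul_assoc, hcomm, ← mul_assoc, ← map_mul, h.incl_mul_proj_last k hx]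
  rw [YH.steinberg_eq, mul_add, map_add, hbraid, hframing]

/-- The idempotent that projects the last three strands onto the residue `k`. -/
def YH.projLastThree (n : ℕ) : YH d u (n + 3) :=
  YH.incl d u (n + 2) (YH.projLastTwo k n) * YH.proj k (Fin.last (n + 2))

lemma IsJuyumayaTrace.projLastThree_mul_steinberg (h : IsJuyumayaTrace d u z x tr)
    (hx : x 0 = 1) :
    tr (n + 3) (YH.projLastThree k n * YH.steinberg n (Nat.lt_succ_self _))
      = ZMod.dft x k / d * (ZMod.dft x k / d + z) * (ZMod.dft x k / d + z * (u + 1)) := by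
  have hcomm : (1 + YH.gLast n) * YH.projLastTwo k n
      = YH.projLastTwo k n * (1 + YH.gLast n : YH d u (n + 2)) :=
    ((Commute.one_left _).add_left (YH.commute_gLast_projLastTwo k n)).eq
  have hsq : YH.proj k (Fin.last (n + 1)) * (1 + YH.gLast n) * YH.projLastTwo k n
      * (1 + YH.gLast n : YH d u (n + 2))
      = (u + 1) • (YH.projLastTwo k n * (1 + YH.gLast n)) := by
    rw [mul_assoc (YH.proj k _), hcomm, ← mul_assoc, YH.proj_last_mul_projLastTwo, mul_assoc,
      ← sq, YH.projLastTwo_mul_one_add_gLast_sq]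
  have htr : tr (n + 2) (YH.projLastTwo k n * (1 + YH.gLast n))
      = ZMod.dft x k / d * (ZMod.dft x k / d + z) := by
    rw [mul_add, mul_one, map_add, h.projLastTwo k hx, h.projLastTwo_mul_gLast k hx]
    ring
  rw [YH.projLastThree, h.incl_mul_proj_last_mul_steinberg k hx, hsq, map_smul, htr, smul_eq_mul]
  ring

lemma YH.projLastThree_eq (n : ℕ) : (YH.projLastThree k n : YH d u (n + 3))
    = YH.proj k ⟨n, by omega⟩ * YH.proj k ⟨n + 1, by omega⟩ * YH.proj k ⟨n + 2, by omega⟩ := by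
  rw [YH.projLastThree, YH.projLastTwo, map_mul, YH.incl_proj, YH.incl_proj]
  rfl

lemma YH.projLastThree_mul_t_pow {n : ℕ} {a b c : ℕ} (h : ((a + b + c : ℕ) : ZMod d) = 0) :
    YH.projLastThree k n * (YH.t ⟨n, by omega⟩ ^ a * YH.t ⟨n + 1, by omega⟩ ^ b
      * YH.t ⟨n + 2, by omega⟩ ^ c : YH d u (n + 3)) = YH.projLastThree k n := by
  have absorb (j : Fin (n + 3)) (m : ℕ) : (YH.proj k j * YH.t j ^ m : YH d u (n + 3))
      = (ZMod.stdAddChar k : ℂ) ^ m • YH.proj k j := by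
    rw [← ((YH.commute_t_proj k j j).pow_left m).eq, YH.t_pow_mul_proj]
  have comm (i j : Fin (n + 3)) (m : ℕ) : Commute (YH.proj k i) (YH.t j ^ m : YH d u (n + 3)) :=
    ((YH.commute_t_proj k j i).pow_left m).symm
  rw [YH.projLastThree_eq,
    ((comm _ _ a).symm.mul_left (comm _ _ b).symm).symm.mul_mul_mul_comm,
    (comm _ _ a).mul_mul_mul_comm, absorb, absorb, absorb, smul_mul_smul_comm,
    smul_mul_smul_comm, ← pow_add, ← pow_add, stdAddChar_pow, h, mul_zero, AddChar.map_zero_eq_one,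
    one_smul]

lemma YH.projLastThree_mul_r (n : ℕ) :
    (YH.projLastThree k n * YH.r n (Nat.lt_succ_self _) : YH d u (n + 3))
      = (d : ℂ) ^ 2 • (YH.projLastThree k n * YH.steinberg n (Nat.lt_succ_self _)) := by
  have hterm (α β : ZMod d) : YH.projLastThree k n
      * (YH.t ⟨n, by omega⟩ ^ α.val * YH.t ⟨n + 1, by omega⟩ ^ β.val
        * YH.t ⟨n + 2, by omega⟩ ^ (-α - β).val : YH d u (n + 3)) = YH.projLastThree k n :=
    YH.projLastThree_mul_t_pow k (by simp)
  rw [YH.r, ← mul_assoc, Finset.mul_sum]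
  simp only [Finset.mul_sum, hterm, Finset.sum_const, Finset.card_univ, ZMod.card]
  rw [← Nat.cast_smul_eq_nsmul ℂ, ← Nat.cast_smul_eq_nsmul ℂ, smul_smul, ← sq, smul_mul_assoc]

end necessary

section passing

variable {d : ℕ} [NeZero d] {u z : ℂ} {x : ZMod d → ℂ} {n : ℕ}

lemma FTL.mk_eq_mk_iff {a b : YH d u n} :
    FTL.mk d u n a = FTL.mk d u n b ↔ a - b ∈ ftlIdeal d u n := by
  rw [← TwoSidedIdeal.rel_iff]
  exact (ftlIdeal d u n).ringCon.eq

lemma tracePasses_iff :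
    TracePasses d u n z x ↔ ∃ tr : ∀ n, YH d u n →ₗ[ℂ] ℂ, IsJuyumayaTrace d u z x tr ∧
      ∀ a ∈ ftlIdeal d u n, tr n a = 0 := by
  refine exists_congr fun tr => and_congr_right fun _ => ⟨?_, fun hzero => ?_⟩
  · rintro ⟨φ, hφ⟩ a ha
    rw [← hφ, FTL.mk_eq_mk_iff.mpr ((sub_zero a).symm ▸ ha : a - 0 ∈ _), map_zero, map_zero]
  · refine ⟨⟨⟨Quotient.lift (tr n) fun a b hab => ?_, ?_⟩, ?_⟩, fun a => rfl⟩
    · have h := hzero _ ((ftlIdeal d u n).rel_iff a b |>.mp hab)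
      rwa [map_sub, sub_eq_zero] at h
    · rintro ⟨a⟩ ⟨b⟩
      exact map_add (tr n) a b
    · rintro r ⟨a⟩
      exact map_smul (tr n) r a

theorem dft_of_tracePasses (hn : 3 ≤ n) (hx : x 0 = 1) (h : TracePasses d u n z x)
    (k : ZMod d) :
    ZMod.dft x k = 0 ∨ ZMod.dft x k = -(d * z) ∨ ZMod.dft x k = -(d * z * (u + 1)) := by
  obtain ⟨tr, htr, hzero⟩ := tracePasses_iff.mp h
  obtain ⟨N, rfl⟩ := Nat.exists_eq_add_of_le' hn
  have hd : (d : ℂ) ≠ 0 := NeZero.ne _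
  have hmem : YH.projLastThree k N * YH.r N (Nat.lt_succ_self _) ∈ ftlIdeal d u (N + 3) :=
    (ftlIdeal d u (N + 3)).mul_mem_left _ _ (TwoSidedIdeal.subset_span ⟨N, _, rfl⟩)
  have hprod := hzero _ hmem
  rw [YH.projLastThree_mul_r, map_smul, htr.projLastThree_mul_steinberg k hx, smul_eq_mul] at hprod
  have hfactor : ZMod.dft x k * (ZMod.dft x k + d * z) * (ZMod.dft x k + d * z * (u + 1)) = 0 := by
    field_simp at hprod
    rw [hprod, mul_zero]
  rcases mul_eq_zero.mp hfactor with hfactor | h₂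
  · rcases mul_eq_zero.mp hfactor with h₀ | h₁
    · exact Or.inl h₀
    · exact Or.inr (Or.inl (eq_neg_of_add_eq_zero_left h₁))
  · exact Or.inr (Or.inr (eq_neg_of_add_eq_zero_left h₂))

end passing

/-! ### A representation on words -/

section words

/-- The letters of the words on which `Y_{d,n}(u)` is represented: two for each residue. -/
abbrev Letter (d : ℕ) : Type := ZMod d × Bool

/-- Functions on the words of length `n`. -/
abbrev WordFun (d n : ℕ) : Type := (Fin n → Letter d) → ℂ

/-- Coefficient of the swapped word in the action of a braiding generator. -/
def swapCoeff {d : ℕ} (u : ℂ) (a b : Letter d) : ℂ :=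
  if a.1 = b.1 then (if a.2 = b.2 then 0 else if b.2 then 1 else u) else 1

/-- Coefficient of the unchanged word in the action of a braiding generator. -/
def stayCoeff {d : ℕ} (u : ℂ) (a b : Letter d) : ℂ :=
  if a.1 = b.1 then (if a.2 = b.2 then -1 else if b.2 then 0 else u - 1) else 0

/-- Multiplication of functions on words by a function of the word, as an operator. -/
abbrev diagOp {d n : ℕ} : WordFun d n →ₐ[ℂ] Module.End ℂ (WordFun d n) :=
  Algebra.lmul ℂ (WordFun d n)

/-- The braiding operator at the places `p` and `q`: on letters of the same residue it is the
Hecke-algebra `R`-matrix with eigenvalues `-1` and `u`, and it swaps letters of different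
residues. -/
def braidOp {d n : ℕ} (u : ℂ) (p q : Fin n) : Module.End ℂ (WordFun d n) :=
  diagOp (fun w => swapCoeff u (w p) (w q)) * LinearMap.funLeft ℂ ℂ (fun w => w ∘ Equiv.swap p q)
    + diagOp (fun w => stayCoeff u (w p) (w q))

/-- Restriction of a function to the words that carry a shorter word at the places `ι` and agree
with `w₀` elsewhere. -/
def wordSlice {d m n : ℕ} (ι : Fin m → Fin n) (w₀ : Fin n → Letter d) :
    WordFun d n →ₗ[ℂ] WordFun d m :=
  LinearMap.funLeft ℂ ℂ fun v => Function.extend ι v w₀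

variable {d n : ℕ} {u : ℂ}

lemma braidOp_apply (p q : Fin n) (f : WordFun d n) (w : Fin n → Letter d) :
    braidOp u p q f w = swapCoeff u (w p) (w q) * f (w ∘ Equiv.swap p q)
      + stayCoeff u (w p) (w q) * f w :=
  rfl

lemma comp_swap_comp_swap (w : Fin n → Letter d) (p q : Fin n) :
    (w ∘ Equiv.swap p q) ∘ Equiv.swap p q = w := by
  ext1 j
  simp

lemma wordSlice_apply {m : ℕ} {ι : Fin m → Fin n} (f : WordFun d n) (w₀ : Fin n → Letter d)
    (v : Fin m → Letter d) : wordSlice ι w₀ f v = f (Function.extend ι v w₀) :=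
  rfl

lemma wordSlice_apply_comp {m : ℕ} {ι : Fin m → Fin n} (hι : ι.Injective) (f : WordFun d n)
    (w : Fin n → Letter d) : wordSlice ι w f (w ∘ ι) = f w := by
  have hext : Function.extend ι (w ∘ ι) w = w := by
    ext1 j
    by_cases hj : ∃ i, ι i = j
    · obtain ⟨i, rfl⟩ := hj
      exact hι.extend_apply _ _ i
    · exact Function.extend_apply' _ _ _ hj
  rw [wordSlice_apply, hext]

lemma wordSlice_braidOp {m : ℕ} {ι : Fin m → Fin n} (hι : ι.Injective) (w₀ : Fin n → Letter d)
    (p q : Fin m) (f : WordFun d n) :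
    wordSlice ι w₀ (braidOp u (ι p) (ι q) f) = braidOp u p q (wordSlice ι w₀ f) := by
  have hswap (v : Fin m → Letter d) : Function.extend ι v w₀ ∘ Equiv.swap (ι p) (ι q)
      = Function.extend ι (v ∘ Equiv.swap p q) w₀ := by
    ext1 j
    by_cases hj : ∃ i, ι i = j
    · obtain ⟨i, rfl⟩ := hj
      rw [Function.comp_apply, ← hι.map_swap, hι.extend_apply, hι.extend_apply,
        Function.comp_apply]
    · have hne (i : Fin m) : j ≠ ι i := fun h => hj ⟨i, h.symm⟩
      rw [Function.comp_apply, Equiv.swap_apply_of_ne_of_ne (hne p) (hne q),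
        Function.extend_apply' _ _ _ hj, Function.extend_apply' _ _ _ hj]
  ext v
  simp only [wordSlice_apply, braidOp_apply, hι.extend_apply, hswap]

lemma braidOp_far {p q r s : Fin n} (hpr : p ≠ r) (hps : p ≠ s) (hqr : q ≠ r) (hqs : q ≠ s) :
    (braidOp u p q * braidOp u r s : Module.End ℂ (WordFun d n))
      = braidOp u r s * braidOp u p q := by
  have hdisjoint : Equiv.Perm.Disjoint (Equiv.swap p q) (Equiv.swap r s) := by
    intro j
    by_cases hj : j = p ∨ j = q
    · rcases hj with rfl | rfl
      exacts [.inr (Equiv.swap_apply_of_ne_of_ne hpr hps),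
        .inr (Equiv.swap_apply_of_ne_of_ne hqr hqs)]
    · rw [not_or] at hj
      exact .inl (Equiv.swap_apply_of_ne_of_ne hj.1 hj.2)
  ext1 f
  ext1 w
  have hswap : (w ∘ Equiv.swap p q) ∘ Equiv.swap r s = (w ∘ Equiv.swap r s) ∘ Equiv.swap p q :=
    congrArg (w ∘ ·) (congrArg DFunLike.coe hdisjoint.commute.eq)
  simp only [Module.End.mul_apply, braidOp_apply, Function.comp_apply, hswap,
    Equiv.swap_apply_of_ne_of_ne hpr.symm hqr.symm, Equiv.swap_apply_of_ne_of_ne hps.symm hqs.symm,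
    Equiv.swap_apply_of_ne_of_ne hpr hps, Equiv.swap_apply_of_ne_of_ne hqr hqs]
  ring

lemma diagOp_mul_braidOp {p q : Fin n} {b c : WordFun d n}
    (hswap : ∀ w, b w = c (w ∘ Equiv.swap p q)) (hstay : ∀ w, (w p).1 = (w q).1 → b w = c w) :
    diagOp b * braidOp u p q = braidOp u p q * diagOp c := by
  ext1 f
  ext1 w
  change b w * braidOp u p q f w = braidOp u p q (c * f) w
  simp only [braidOp_apply, Pi.mul_apply, ← hswap]
  by_cases h : (w p).1 = (w q).1
  · rw [hstay w h]; ring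
  · simp only [stayCoeff, h, if_false]; ring

lemma braidOp_sq (p q : Fin n) :
    (braidOp u p q ^ 2 : Module.End ℂ (WordFun d n))
      = 1 + (u - 1) • diagOp (fun w => if (w p).1 = (w q).1 then 1 else 0)
        + (u - 1) • (diagOp (fun w => if (w p).1 = (w q).1 then 1 else 0) * braidOp u p q) := by
  ext1 f
  ext1 w
  change braidOp u p q (braidOp u p q f) w
    = f w + (u - 1) * ((if (w p).1 = (w q).1 then 1 else 0) * f w)
      + (u - 1) * ((if (w p).1 = (w q).1 then 1 else 0) * braidOp u p q f w)
  simp only [braidOp_apply, Function.comp_apply, comp_swap_comp_swap, Equiv.swap_apply_left,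
    Equiv.swap_apply_right]
  generalize f (w ∘ Equiv.swap p q) = F₁
  generalize f w = F
  obtain ⟨k, x⟩ := w p
  obtain ⟨l, y⟩ := w q
  by_cases hkl : k = l
  · subst hkl
    cases x <;> cases y <;> simp [swapCoeff, stayCoeff] <;> ring
  · simp [swapCoeff, stayCoeff, hkl, Ne.symm hkl]

end words

section threeLetters

variable {d n : ℕ} {u : ℂ}

lemma braidOp_zero_one_apply (f : WordFun d 3) (a b c : Letter d) :
    braidOp u 0 1 f ![a, b, c] = swapCoeff u a b * f ![b, a, c]
      + stayCoeff u a b * f ![a, b, c] := by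
  have hswap : ![a, b, c] ∘ Equiv.swap 0 1 = ![b, a, c] := by
    ext1 j
    fin_cases j <;> rfl
  rw [braidOp_apply, hswap]
  rfl

lemma braidOp_one_two_apply (f : WordFun d 3) (a b c : Letter d) :
    braidOp u 1 2 f ![a, b, c] = swapCoeff u b c * f ![a, c, b]
      + stayCoeff u b c * f ![a, b, c] := by
  have hswap : ![a, b, c] ∘ Equiv.swap 1 2 = ![a, c, b] := by
    ext1 j
    fin_cases j <;> rfl
  rw [braidOp_apply, hswap]
  rfl

lemma braidOp_yangBaxter :
    (braidOp u 0 1 * braidOp u 1 2 * braidOp u 0 1 : Module.End ℂ (WordFun d 3))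
      = braidOp u 1 2 * braidOp u 0 1 * braidOp u 1 2 := by
  ext1 f
  ext1 w
  obtain ⟨a, b, c, rfl⟩ : ∃ a b c, w = ![a, b, c] :=
    ⟨w 0, w 1, w 2, by ext1 j; fin_cases j <;> rfl⟩
  simp only [Module.End.mul_apply, braidOp_zero_one_apply, braidOp_one_two_apply]
  obtain ⟨k, x⟩ := a
  obtain ⟨l, y⟩ := b
  obtain ⟨m, v⟩ := c
  by_cases hkl : k = l
  · subst hkl
    by_cases hkm : k = m
    · subst hkm
      cases x <;> cases y <;> cases v <;> simp [swapCoeff, stayCoeff] <;> ring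
    · cases x <;> cases y <;> cases v <;> simp [swapCoeff, stayCoeff, hkm, Ne.symm hkm]
  · by_cases hkm : k = m
    · subst hkm
      cases x <;> cases y <;> cases v <;> simp [swapCoeff, stayCoeff, hkl, Ne.symm hkl]
    · by_cases hlm : l = m
      · subst hlm
        cases x <;> cases y <;> cases v <;> simp [swapCoeff, stayCoeff, hkl, Ne.symm hkl]
      · simp [swapCoeff, stayCoeff, hkl, hkm, hlm, Ne.symm hkl, Ne.symm hlm]

/-- It matters here that there are only two letters for each residue: the antisymmetrizer of three
strands vanishes on the tensor cube of a two-dimensional space. -/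
lemma braidOp_steinberg_apply (k : ZMod d) (x y v : Bool) (f : WordFun d 3) :
    (braidOp u 0 1 * braidOp u 1 2 * braidOp u 0 1 + braidOp u 1 2 * braidOp u 0 1
      + braidOp u 0 1 * braidOp u 1 2 + braidOp u 0 1 + braidOp u 1 2 + 1 : Module.End ℂ _) f
      ![(k, x), (k, y), (k, v)] = 0 := by
  simp only [LinearMap.add_apply, Pi.add_apply, Module.End.mul_apply, Module.End.one_apply,
    braidOp_zero_one_apply, braidOp_one_two_apply]
  cases x <;> cases y <;> cases v <;> simp [swapCoeff, stayCoeff] <;> ring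

lemma injective_vecCons_three {α : Type*} {p q r : α} (hpq : p ≠ q) (hqr : q ≠ r) (hpr : p ≠ r) :
    Function.Injective ![p, q, r] := by
  intro i j hij
  fin_cases i <;> fin_cases j <;> simp_all

lemma braidOp_braid {p q r : Fin n} (hpq : p ≠ q) (hqr : q ≠ r) (hpr : p ≠ r) :
    (braidOp u p q * braidOp u q r * braidOp u p q : Module.End ℂ (WordFun d n))
      = braidOp u q r * braidOp u p q * braidOp u q r := by
  have hι := injective_vecCons_three hpq hqr hpr
  ext1 f
  ext1 w
  have slice₁ (f : WordFun d n) : wordSlice ![p, q, r] w (braidOp u p q f)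
      = braidOp u 0 1 (wordSlice ![p, q, r] w f) := wordSlice_braidOp hι w 0 1 f
  have slice₂ (f : WordFun d n) : wordSlice ![p, q, r] w (braidOp u q r f)
      = braidOp u 1 2 (wordSlice ![p, q, r] w f) := wordSlice_braidOp hι w 1 2 f
  refine (wordSlice_apply_comp hι _ w).symm.trans (Eq.trans ?_ (wordSlice_apply_comp hι _ w))
  simp only [Module.End.mul_apply, slice₁, slice₂]
  exact congrFun (LinearMap.congr_fun braidOp_yangBaxter (wordSlice ![p, q, r] w f)) _

end threeLetters

section wordRep

variable {d : ℕ} [NeZero d] {u : ℂ} {n : ℕ}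

/-- The character of the residue of a letter, by which a framing generator acts on words. -/
def framingChar (j : Fin n) : WordFun d n := fun w => ZMod.stdAddChar (w j).1

lemma framingAverage_stdAddChar (k l : ZMod d) :
    framingAverage d (ZMod.stdAddChar k : ℂ) (ZMod.stdAddChar l) = if k = l then 1 else 0 := by
  have hterm : ∀ s ∈ Finset.range d, (ZMod.stdAddChar k ^ s * ZMod.stdAddChar l ^ (d - s) : ℂ)
      = ZMod.stdAddChar ((k - l) * (s : ZMod d)) := by
    intro s hs
    rw [stdAddChar_pow, stdAddChar_pow, ← AddChar.map_add_eq_mul,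
      Nat.cast_sub (Finset.mem_range.mp hs).le, ZMod.natCast_self]
    ring_nf
  rw [framingAverage, Finset.sum_congr rfl hterm,
    sum_range_natCast_zmod fun s => ZMod.stdAddChar ((k - l) * s), sum_stdAddChar_mul]
  simp [sub_eq_zero, NeZero.ne d]

lemma framingAverage_framingChar (p q : Fin n) :
    framingAverage d (framingChar p) (framingChar q)
      = (fun w => if (w p).1 = (w q).1 then 1 else 0 : WordFun d n) := by
  ext1 w
  exact (map_framingAverage (Pi.evalAlgHom ℂ (fun _ => ℂ) w) d _ _).trans
    (framingAverage_stdAddChar _ _)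

/-- The operators of the generators. -/
def wordOp (u : ℂ) : Gen n → Module.End ℂ (WordFun d n)
  | Gen.g i hi => braidOp u ⟨i, Nat.lt_of_succ_lt hi⟩ ⟨i + 1, hi⟩
  | Gen.t j => diagOp (framingChar j)

lemma framingChar_strandSwap (i : ℕ) (hi : i + 1 < n) (j : Fin n) {w : Fin n → Letter d}
    (hw : (w ⟨i, Nat.lt_of_succ_lt hi⟩).1 = (w ⟨i + 1, hi⟩).1) :
    framingChar (strandSwap i hi j) w = framingChar j w := by
  rw [framingChar, framingChar, strandSwap, Equiv.swap_apply_def]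
  split_ifs with hleft hright
  · rw [hleft, hw]
  · rw [hright, hw]
  · rfl

lemma wordOp_rel ⦃a b : FreeAlgebra ℂ (Gen n)⦄ (h : YHRel d u n a b) :
    FreeAlgebra.lift ℂ (wordOp (d := d) u) a = FreeAlgebra.lift ℂ (wordOp u) b := by
  cases h with
  | far i j hi hj hij =>
      simp only [map_mul, FreeAlgebra.lift_ι_apply, wordOp]
      apply braidOp_far <;> simp only [ne_eq, Fin.mk.injEq] <;> omega
  | braid i hi hj =>
      simp only [map_mul, FreeAlgebra.lift_ι_apply, wordOp]
      apply braidOp_braid <;> simp only [ne_eq, Fin.mk.injEq] <;> omega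
  | framing_comm i j =>
      simp only [map_mul, FreeAlgebra.lift_ι_apply, wordOp]
      exact (Commute.all _ _).map diagOp
  | framing_braid i hi j =>
      simp only [map_mul, FreeAlgebra.lift_ι_apply, wordOp]
      exact diagOp_mul_braidOp (fun w => by simp [framingChar, strandSwap])
        fun w hw => (framingChar_strandSwap i hi j hw).symm
  | framing_pow j =>
      have hpow : (framingChar j : WordFun d n) ^ d = 1 := funext fun w => stdAddChar_pow_eq_one _
      rw [map_pow, map_one, FreeAlgebra.lift_ι_apply, wordOp, ← map_pow, hpow, map_one]
  | quadratic i hi =>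
      simp only [map_add, map_mul, map_pow, map_smul, map_one, fe, map_framingAverage,
        FreeAlgebra.lift_ι_apply, wordOp]
      rw [← map_framingAverage diagOp, framingAverage_framingChar]
      exact braidOp_sq _ _

/-- The representation of `Y_{d,n}(u)` on functions on words. -/
def wordRep (d : ℕ) [NeZero d] (u : ℂ) (n : ℕ) : YH d u n →ₐ[ℂ] Module.End ℂ (WordFun d n) :=
  RingQuot.liftAlgHom ℂ ⟨FreeAlgebra.lift ℂ (wordOp u), wordOp_rel⟩

lemma wordRep_g (i : ℕ) (hi : i + 1 < n) :
    wordRep d u n (YH.g i hi) = braidOp u ⟨i, Nat.lt_of_succ_lt hi⟩ ⟨i + 1, hi⟩ := by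
  simp [wordRep, YH.g, YH.mk, wordOp]

lemma wordRep_t (j : Fin n) : wordRep d u n (YH.t j) = diagOp (framingChar j) := by
  simp [wordRep, YH.t, YH.mk, wordOp]

lemma wordRep_steinberg_apply (i : ℕ) (hi : i + 2 < n) (f : WordFun d n) (w : Fin n → Letter d)
    (h₁ : (w ⟨i, Nat.lt_of_succ_lt (Nat.lt_of_succ_lt hi)⟩).1 = (w ⟨i + 2, hi⟩).1)
    (h₂ : (w ⟨i + 1, Nat.lt_of_succ_lt hi⟩).1 = (w ⟨i + 2, hi⟩).1) :
    wordRep d u n (YH.steinberg i hi) f w = 0 := by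
  let p : Fin n := ⟨i, Nat.lt_of_succ_lt (Nat.lt_of_succ_lt hi)⟩
  let q : Fin n := ⟨i + 1, Nat.lt_of_succ_lt hi⟩
  let r : Fin n := ⟨i + 2, hi⟩
  have hι : Function.Injective ![p, q, r] :=
    injective_vecCons_three (by simp [p, q]) (by simp [q, r]) (by simp [p, r])
  have slice₁ (f : WordFun d n) : wordSlice ![p, q, r] w (braidOp u p q f)
      = braidOp u 0 1 (wordSlice ![p, q, r] w f) := wordSlice_braidOp hι w 0 1 f
  have slice₂ (f : WordFun d n) : wordSlice ![p, q, r] w (braidOp u q r f)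
      = braidOp u 1 2 (wordSlice ![p, q, r] w f) := wordSlice_braidOp hι w 1 2 f
  have hw : w ∘ ![p, q, r] = ![((w r).1, (w p).2), ((w r).1, (w q).2), ((w r).1, (w r).2)] := by
    ext1 j
    fin_cases j
    exacts [Prod.ext h₁ rfl, Prod.ext h₂ rfl, rfl]
  have h := braidOp_steinberg_apply (u := u) (w r).1 (w p).2 (w q).2 (w r).2
    (wordSlice ![p, q, r] w f)
  refine (wordSlice_apply_comp hι _ w).symm.trans ?_
  rw [hw, ← h]
  simp only [YH.steinberg, map_add, map_mul, map_one, wordRep_g, LinearMap.add_apply,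
    Module.End.mul_apply, Module.End.one_apply, ← slice₁, ← slice₂]
  rfl

lemma sum_sum_stdAddChar (a b c : ZMod d) :
    ∑ α : ZMod d, ∑ β : ZMod d, (ZMod.stdAddChar (a * α) * ZMod.stdAddChar (b * β)
        * ZMod.stdAddChar (c * (-α - β)) : ℂ)
      = if a = c ∧ b = c then (d : ℂ) ^ 2 else 0 := by
  have hterm (α β : ZMod d) : (ZMod.stdAddChar (a * α) * ZMod.stdAddChar (b * β)
      * ZMod.stdAddChar (c * (-α - β)) : ℂ)
      = ZMod.stdAddChar ((a - c) * α) * ZMod.stdAddChar ((b - c) * β) := by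
    simp only [← AddChar.map_add_eq_mul]
    ring_nf
  simp only [hterm, ← Finset.mul_sum, ← Finset.sum_mul, sum_stdAddChar_mul, sub_eq_zero]
  split_ifs <;> simp_all [sq]

lemma wordRep_r (i : ℕ) (hi : i + 2 < n) : wordRep d u n (YH.r i hi) = 0 := by
  refine LinearMap.ext fun f => funext fun w => ?_
  have hsum (g : WordFun d n) : (∑ α : ZMod d, ∑ β : ZMod d,
      wordRep d u n (YH.t ⟨i, Nat.lt_of_succ_lt (Nat.lt_of_succ_lt hi)⟩ ^ α.val
        * YH.t ⟨i + 1, Nat.lt_of_succ_lt hi⟩ ^ β.val * YH.t ⟨i + 2, hi⟩ ^ (-α - β).val)) g w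
      = (if (w ⟨i, Nat.lt_of_succ_lt (Nat.lt_of_succ_lt hi)⟩).1 = (w ⟨i + 2, hi⟩).1
          ∧ (w ⟨i + 1, Nat.lt_of_succ_lt hi⟩).1 = (w ⟨i + 2, hi⟩).1
        then (d : ℂ) ^ 2 else 0) * g w := by
    simp only [← sum_sum_stdAddChar, Finset.sum_mul, LinearMap.sum_apply, Finset.sum_apply]
    refine Finset.sum_congr rfl fun α _ => Finset.sum_congr rfl fun β _ => ?_
    simp only [map_mul, map_pow, wordRep_t]
    rw [← map_pow, ← map_pow, ← map_pow, ← map_mul, ← map_mul]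
    change (_ * _ * _) * g w = _
    simp only [Pi.pow_apply, framingChar, stdAddChar_pow, ZMod.natCast_zmod_val]
  rw [YH.r, map_mul, Module.End.mul_apply]
  simp only [map_sum]
  rw [hsum]
  split_ifs with h
  · rw [wordRep_steinberg_apply i hi f w h.1 h.2, mul_zero]
    rfl
  · exact zero_mul _

lemma wordRep_eq_zero {a : YH d u n} (ha : a ∈ ftlIdeal d u n) : wordRep d u n a = 0 := by
  have hker : a ∈ TwoSidedIdeal.ker (wordRep d u n) := by
    refine TwoSidedIdeal.mem_span_iff.mp ha _ ?_
    rintro _ ⟨i, hi, rfl⟩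
    exact (TwoSidedIdeal.mem_ker _).mpr (wordRep_r i hi)
  exact (TwoSidedIdeal.mem_ker _).mp hker

end wordRep

/-! ### Weighted traces of the representation -/

section restrictLast

variable {d : ℕ} {u : ℂ} {n : ℕ} (c : Letter d)

/-- Restriction of a function to the words with last letter `c`. -/
def restrictLast : WordFun d (n + 1) →ₗ[ℂ] WordFun d n := wordSlice Fin.castSucc fun _ => c

/-- Extension of a function by zero to the words with last letter different from `c`. -/
def extendLast : WordFun d n →ₗ[ℂ] WordFun d (n + 1) :=
  diagOp (fun w => if w (Fin.last n) = c then 1 else 0) ∘ₗ LinearMap.funLeft ℂ ℂ Fin.init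

lemma restrictLast_apply (f : WordFun d (n + 1)) (v : Fin n → Letter d) :
    restrictLast c f v = f (Fin.snoc v c) := by
  have hextend : Function.extend Fin.castSucc v (fun _ => c) = Fin.snoc v c := by
    ext1 j
    cases j using Fin.lastCases with
    | last =>
        rw [Fin.snoc_last, Function.extend_apply' _ _ _ fun ⟨i, hi⟩ => Fin.castSucc_ne_last i hi]
    | cast j => rw [Fin.snoc_castSucc, (Fin.castSucc_injective n).extend_apply]
  rw [restrictLast, wordSlice_apply, hextend]

lemma extendLast_apply (f : WordFun d n) (w : Fin (n + 1) → Letter d) :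
    extendLast c f w = if w (Fin.last n) = c then f (Fin.init w) else 0 := by
  change (if _ then (1 : ℂ) else 0) * _ = _
  rw [ite_mul, one_mul, zero_mul]
  rfl

lemma extendLast_apply_snoc (f : WordFun d n) (v : Fin n → Letter d) :
    extendLast c f (Fin.snoc v c) = f v := by
  rw [extendLast_apply, Fin.snoc_last, if_pos rfl, Fin.init_snoc]

lemma restrictLast_comp_diagOp_comp_extendLast (b : WordFun d (n + 1)) :
    restrictLast c ∘ₗ diagOp b ∘ₗ extendLast c = diagOp (restrictLast c b) := by
  refine LinearMap.ext fun f => funext fun v => ?_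
  change restrictLast c (b * extendLast c f) v = restrictLast c b v * f v
  rw [restrictLast_apply, restrictLast_apply, Pi.mul_apply, extendLast_apply_snoc]

lemma restrictLast_comp_braidOp_comp_extendLast :
    restrictLast c ∘ₗ braidOp u (Fin.last n).castSucc (Fin.last (n + 1)) ∘ₗ extendLast c
      = diagOp fun v => stayCoeff u (v (Fin.last n)) c := by
  refine LinearMap.ext fun f => funext fun v => ?_
  change restrictLast c (braidOp u _ _ (extendLast c f)) v = stayCoeff u (v (Fin.last n)) c * f v
  rw [restrictLast_apply, braidOp_apply, extendLast_apply_snoc, extendLast_apply,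
    Fin.snoc_castSucc, Fin.snoc_last, Function.comp_apply, Equiv.swap_apply_right,
    Fin.snoc_castSucc]
  split_ifs with h
  · simp [h, swapCoeff]
  · rw [mul_zero, zero_add]

variable [NeZero d]

lemma sum_extendLast_comp_restrictLast :
    ∑ c, extendLast c ∘ₗ restrictLast c = (1 : Module.End ℂ (WordFun d (n + 1))) := by
  refine LinearMap.ext fun f => funext fun w => ?_
  simp only [LinearMap.sum_apply, Finset.sum_apply, LinearMap.comp_apply, extendLast_apply,
    restrictLast_apply, Finset.sum_ite_eq, Finset.mem_univ, if_true, Fin.snoc_init_self]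
  rfl

lemma trace_eq_sum_restrictLast (T : Module.End ℂ (WordFun d (n + 1))) :
    LinearMap.trace ℂ _ T
      = ∑ c, LinearMap.trace ℂ (WordFun d n) (restrictLast c ∘ₗ T ∘ₗ extendLast c) := by
  conv_lhs => rw [← mul_one T, ← sum_extendLast_comp_restrictLast, Finset.mul_sum, map_sum]
  refine Finset.sum_congr rfl fun c _ => ?_
  rw [Module.End.mul_eq_comp, ← LinearMap.comp_assoc, LinearMap.trace_comp_comm']

lemma restrictLast_comp_wordRep_incl (a : YH d u n) :
    restrictLast c ∘ₗ wordRep d u (n + 1) (YH.incl d u n a)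
      = wordRep d u n a ∘ₗ restrictLast c := by
  induction a using YH.induction with
  | g i hi =>
      rw [YH.incl_g, wordRep_g, wordRep_g]
      exact LinearMap.ext fun f =>
        wordSlice_braidOp (Fin.castSucc_injective n) _ ⟨i, _⟩ ⟨i + 1, _⟩ f
  | t j =>
      have hchar : restrictLast c (framingChar j.castSucc) = framingChar j := by
        ext1 v
        rw [restrictLast_apply, framingChar, framingChar, Fin.snoc_castSucc]
      rw [YH.incl_t, wordRep_t, wordRep_t, ← hchar]
      rfl
  | algebraMap r =>
      refine LinearMap.ext fun f => ?_
      simp only [AlgHom.commutes, LinearMap.comp_apply, Module.algebraMap_end_apply, map_smul]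
  | mul a b ha hb =>
      rw [map_mul, map_mul, map_mul, Module.End.mul_eq_comp, Module.End.mul_eq_comp,
        ← LinearMap.comp_assoc, ha, LinearMap.comp_assoc, hb, LinearMap.comp_assoc]
  | add a b ha hb =>
      rw [map_add, map_add, map_add, LinearMap.comp_add, LinearMap.add_comp, ha, hb]

end restrictLast

section wordTrace

variable {d : ℕ} {u z : ℂ} {x : ZMod d → ℂ} {n : ℕ} {κ : Letter d → ℂ}

/-- The product of the weights of the letters of a word. -/
def wordWeight (κ : Letter d → ℂ) : WordFun d n := fun w => ∏ j, κ (w j)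

lemma restrictLast_wordWeight (c : Letter d) :
    restrictLast c (wordWeight κ : WordFun d (n + 1)) = κ c • wordWeight κ := by
  ext1 v
  rw [restrictLast_apply, Pi.smul_apply, wordWeight, Fin.prod_univ_castSucc, Fin.snoc_last,
    smul_eq_mul, mul_comm]
  simp only [Fin.snoc_castSucc, wordWeight]

variable [NeZero d]

lemma wordWeight_commute (a : YH d u n) : Commute (diagOp (wordWeight κ)) (wordRep d u n a) := by
  refine YH.commute_algHom _ (fun i hi => ?_) (fun j => ?_) a
  · rw [wordRep_g]
    exact diagOp_mul_braidOp (fun w => (Equiv.prod_comp (Equiv.swap _ _) fun j => κ (w j)).symm)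
      fun w _ => rfl
  · rw [wordRep_t]
    exact (Commute.all _ _).map diagOp

/-- The trace of the representation on words, weighted by the letters. -/
def wordTrace (u : ℂ) (κ : Letter d → ℂ) (n : ℕ) : YH d u n →ₗ[ℂ] ℂ :=
  LinearMap.trace ℂ _ ∘ₗ LinearMap.mulLeft ℂ (diagOp (wordWeight κ)) ∘ₗ
    (wordRep d u n).toLinearMap

lemma wordTrace_apply (a : YH d u n) :
    wordTrace u κ n a = LinearMap.trace ℂ _ (diagOp (wordWeight κ) * wordRep d u n a) :=
  rfl

lemma wordTrace_mul_comm (a b : YH d u n) :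
    wordTrace u κ n (a * b) = wordTrace u κ n (b * a) := by
  rw [wordTrace_apply, map_mul (wordRep d u n), ← mul_assoc, (wordWeight_commute a).eq, mul_assoc,
    LinearMap.trace_mul_comm, mul_assoc, ← map_mul (wordRep d u n), wordTrace_apply]

/-- Taking the trace over the last letter first reduces the Markov property to an identity between
weights. -/
lemma wordTrace_incl_mul {b : YH d u (n + 1)} {s : Letter d → WordFun d n} {Z : ℂ}
    (hs : ∀ c, restrictLast c ∘ₗ wordRep d u (n + 1) b ∘ₗ extendLast c = diagOp (s c))
    (hZ : ∀ v, wordWeight κ v * ∑ c, κ c * s c v = Z * wordWeight κ v) (a : YH d u n) :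
    wordTrace u κ (n + 1) (YH.incl d u n a * b) = Z * wordTrace u κ n a := by
  have hslice (c : Letter d) : restrictLast c ∘ₗ
      (diagOp (wordWeight κ) * wordRep d u (n + 1) (YH.incl d u n a * b)) ∘ₗ extendLast c
      = diagOp (κ c • wordWeight κ) * wordRep d u n a * diagOp (s c) := by
    have hweight : restrictLast c ∘ₗ diagOp (wordWeight κ : WordFun d (n + 1))
        = diagOp (κ c • wordWeight κ) ∘ₗ restrictLast c := by
      rw [← restrictLast_wordWeight]
      rfl
    simp only [map_mul, Module.End.mul_eq_comp, LinearMap.comp_assoc, ← hs c]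
    rw [← LinearMap.comp_assoc, hweight, LinearMap.comp_assoc,
      ← LinearMap.comp_assoc _ _ (restrictLast c), restrictLast_comp_wordRep_incl,
      LinearMap.comp_assoc]
  have hsum : ∑ c, s c * (κ c • wordWeight κ) = Z • wordWeight κ := by
    ext1 v
    rw [Finset.sum_apply, Pi.smul_apply, smul_eq_mul, ← hZ v, Finset.mul_sum]
    refine Finset.sum_congr rfl fun c _ => ?_
    rw [Pi.mul_apply, Pi.smul_apply, smul_eq_mul]
    ring
  rw [wordTrace_apply, trace_eq_sum_restrictLast]
  simp only [hslice, LinearMap.trace_mul_comm _ _ (diagOp (s _)), ← mul_assoc, ← map_mul]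
  rw [← map_sum, ← Finset.sum_mul, ← map_sum, hsum, map_smul, smul_mul_assoc, map_smul,
    smul_eq_mul, wordTrace_apply]

/-- The conditions on the weights of the letters under which the weighted trace is the Juyumaya
trace with parameters `z` and `x`. -/
structure IsMarkovWeight (u z : ℂ) (x : ZMod d → ℂ) (κ : Letter d → ℂ) : Prop where
  total : ∑ c, κ c = 1
  framing : ∀ m : ZMod d, ∑ c, κ c * ZMod.stdAddChar (c.1 * m) = x m
  stay : ∀ a, κ a * ∑ c, κ c * stayCoeff u a c = z * κ a

lemma IsMarkovWeight.wordTrace_incl_mul_t_last_pow (h : IsMarkovWeight u z x κ) (a : YH d u n)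
    (m : ℕ) : wordTrace u κ (n + 1) (YH.incl d u n a * YH.t (Fin.last n) ^ m)
      = x (m : ZMod d) * wordTrace u κ n a := by
  have hchar (c : Letter d) : restrictLast c (framingChar (Fin.last n) ^ m : WordFun d (n + 1))
      = fun _ => ZMod.stdAddChar (c.1 * (m : ZMod d)) := by
    ext1 v
    rw [restrictLast_apply, Pi.pow_apply, framingChar, stdAddChar_pow, Fin.snoc_last]
  refine wordTrace_incl_mul (s := fun c _ => ZMod.stdAddChar (c.1 * (m : ZMod d))) (fun c => ?_)
    (fun v => ?_) a
  · rw [map_pow, wordRep_t, ← map_pow, restrictLast_comp_diagOp_comp_extendLast, hchar]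
  · rw [h.framing, mul_comm]

lemma IsMarkovWeight.wordTrace_incl (h : IsMarkovWeight u z x κ) (a : YH d u n) :
    wordTrace u κ (n + 1) (YH.incl d u n a) = wordTrace u κ n a := by
  have hx : x 0 = 1 := by simpa [h.total] using (h.framing 0).symm
  simpa [hx] using h.wordTrace_incl_mul_t_last_pow a 0

lemma IsMarkovWeight.wordTrace_incl_mul_gLast (h : IsMarkovWeight u z x κ)
    (a : YH d u (n + 1)) :
    wordTrace u κ (n + 2) (YH.incl d u (n + 1) a * YH.gLast n)
      = z * wordTrace u κ (n + 1) a := by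
  refine wordTrace_incl_mul (s := fun c v => stayCoeff u (v (Fin.last n)) c) (fun c => ?_)
    (fun v => ?_) a
  · rw [wordRep_g]
    exact restrictLast_comp_braidOp_comp_extendLast c
  · rw [wordWeight, Fin.prod_univ_castSucc, mul_assoc, h.stay]
    ring

lemma IsMarkovWeight.wordTrace_one (h : IsMarkovWeight u z x κ) (n : ℕ) :
    wordTrace u κ n 1 = 1 := by
  induction n with
  | zero =>
      have hweight : (wordWeight κ : WordFun d 0) = 1 := rfl
      rw [wordTrace_apply, map_one, mul_one, hweight, map_one, LinearMap.trace_one]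
      simp
  | succ n ih => rw [← map_one (YH.incl d u n), h.wordTrace_incl, ih]

theorem IsMarkovWeight.isJuyumayaTrace (h : IsMarkovWeight u z x κ) :
    IsJuyumayaTrace d u z x (wordTrace u κ) where
  compatible _ := h.wordTrace_incl
  one := h.wordTrace_one
  mul_comm _ := wordTrace_mul_comm
  braiding _ := h.wordTrace_incl_mul_gLast
  framing _ a m _ _ := h.wordTrace_incl_mul_t_last_pow a m

theorem IsMarkovWeight.tracePasses (h : IsMarkovWeight u z x κ) (n : ℕ) :
    TracePasses d u n z x :=
  tracePasses_iff.mpr ⟨wordTrace u κ, h.isJuyumayaTrace, fun a ha => by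
    rw [wordTrace_apply, wordRep_eq_zero ha, mul_zero, map_zero]⟩

end wordTrace

section subsetWeight

variable {d : ℕ} [NeZero d] {u z : ℂ} {D : Finset (ZMod d)} {p q : ℂ}

/-- The weights `p / |D|` and `q / |D|` on the two letters of each residue in `D`, and `0` on the
other letters. -/
def subsetWeight (D : Finset (ZMod d)) (p q : ℂ) (c : Letter d) : ℂ :=
  if c.1 ∈ D then (D.card : ℂ)⁻¹ * (if c.2 then q else p) else 0

lemma sum_subsetWeight_mul (f : Letter d → ℂ) :
    ∑ c, subsetWeight D p q c * f c
      = (D.card : ℂ)⁻¹ * ∑ k ∈ D, (p * f (k, false) + q * f (k, true)) := by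
  rw [Fintype.sum_prod_type, ← Finset.sum_subset (Finset.subset_univ D), Finset.mul_sum]
  · refine Finset.sum_congr rfl fun k hk => ?_
    simp only [subsetWeight, hk, if_true, Fintype.sum_bool, Bool.false_eq_true, if_false]
    ring
  · intro k _ hk
    simp [subsetWeight, hk]

lemma isMarkovWeight_subsetWeight (hD : D.Nonempty) (hpq : p + q = 1)
    (hp : -(p * p) = z * D.card * p) (hq : q * ((u - 1) * p - q) = z * D.card * q) :
    IsMarkovWeight u z (eSolution D) (subsetWeight D p q) := by
  have hcard : (D.card : ℂ) ≠ 0 := Nat.cast_ne_zero.mpr hD.card_pos.ne'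
  have framing (m : ZMod d) :
      ∑ c, subsetWeight D p q c * ZMod.stdAddChar (c.1 * m) = eSolution D m := by
    rw [sum_subsetWeight_mul]
    simp only [← add_mul, hpq, one_mul, eSolution]
  refine ⟨by simpa [eSolution, hcard] using framing 0, framing, fun ⟨k, b⟩ => ?_⟩
  by_cases hk : k ∈ D
  · rw [sum_subsetWeight_mul, Finset.sum_eq_single_of_mem k hk fun l _ hl => by
      simp [stayCoeff, hl.symm]]
    cases b
    · simp only [subsetWeight, hk, stayCoeff, if_true, Bool.false_eq_true, if_false]
      field_simp
      simp only [mul_zero, add_zero, mul_neg]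
      linear_combination hp
    · simp only [subsetWeight, hk, stayCoeff, if_true, Bool.false_eq_true, if_false]
      field_simp
      simp only [Bool.true_eq_false, ↓reduceIte]
      linear_combination hq
  · simp [subsetWeight, hk]

theorem tracePasses_eSolution_of_add_one (n : ℕ) (hu : u + 1 ≠ 0) (hD : D.Nonempty) :
    TracePasses d u n (-1 / ((u + 1) * D.card)) (eSolution D) := by
  have hcard : (D.card : ℂ) ≠ 0 := Nat.cast_ne_zero.mpr hD.card_pos.ne'
  have hweight := isMarkovWeight_subsetWeight (u := u) (z := -1 / ((u + 1) * D.card))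
    (p := 1 / (u + 1)) (q := u / (u + 1)) hD
  refine (hweight ?_ ?_ ?_).tracePasses n
  · field_simp
    ring
  · field_simp
  · field_simp
    ring

theorem tracePasses_eSolution (n : ℕ) (hD : D.Nonempty) :
    TracePasses d u n (-1 / D.card) (eSolution D) := by
  have hcard : (D.card : ℂ) ≠ 0 := Nat.cast_ne_zero.mpr hD.card_pos.ne'
  refine (isMarkovWeight_subsetWeight (p := 1) (q := 0) hD ?_ ?_ ?_).tracePasses n
  · simp
  · field_simp
  · simp

end subsetWeight

/-! ### The E-system and the Fourier transform -/

section ESystem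

variable {d : ℕ} [NeZero d] {x : ZMod d → ℂ} {C : ℂ} {D : Finset (ZMod d)}

lemma dft_eSolution (D : Finset (ZMod d)) (k : ZMod d) :
    ZMod.dft (eSolution D) k = if k ∈ D then (d : ℂ) * (D.card : ℂ)⁻¹ else 0 := by
  have hd : (d : ℂ) ≠ 0 := NeZero.ne _
  have hinv : eSolution D
      = ZMod.dft.symm fun k => if k ∈ D then (d : ℂ) * (D.card : ℂ)⁻¹ else 0 := by
    ext1 m
    simp only [eSolution, ZMod.invDFT_apply, smul_eq_mul, mul_ite, mul_zero]
    rw [Finset.sum_ite_mem, Finset.univ_inter, ← Finset.sum_mul]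
    field_simp
  rw [hinv, LinearEquiv.apply_symm_apply]

lemma dft_eSolution_ne_zero_iff (hD : D.Nonempty) {k : ZMod d} :
    ZMod.dft (eSolution D) k ≠ 0 ↔ k ∈ D := by
  simp [dft_eSolution, NeZero.ne d, hD.ne_empty]

lemma eSolution_zero (hD : D.Nonempty) : eSolution D 0 = 1 := by
  simp [eSolution, hD.ne_empty]

lemma dft_EVal (x : ZMod d → ℂ) (k : ZMod d) :
    ZMod.dft (EVal x) k = (d : ℂ)⁻¹ * ZMod.dft x k ^ 2 := by
  simp only [ZMod.dft_apply, EVal, smul_eq_mul, sq, Finset.mul_sum, Finset.sum_mul]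
  rw [Finset.sum_comm, ← Equiv.sum_comp (Equiv.neg (ZMod d))]
  refine Finset.sum_congr rfl fun s _ => ?_
  rw [← Equiv.sum_comp (Equiv.addRight s)]
  refine Finset.sum_congr rfl fun m _ => ?_
  have hchar : ZMod.stdAddChar (-((m + s) * k))
      = ZMod.stdAddChar (-(m * k)) * ZMod.stdAddChar (-(s * k)) := by
    rw [← AddChar.map_add_eq_mul, add_mul, neg_add]
  simp only [Equiv.neg_apply, Equiv.coe_addRight, hchar, neg_neg, add_neg_cancel_right]
  ring

lemma IsESolution.eVal_eq_smul (h : IsESolution x) : EVal x = EVal x 0 • x := by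
  ext1 m
  rw [Pi.smul_apply, smul_eq_mul, mul_comm]
  rcases eq_or_ne m 0 with rfl | hm
  · rw [h.1, one_mul]
  · exact h.2 m hm

lemma eVal_eq_smul_of_dft (h : ∀ k, ZMod.dft x k = 0 ∨ ZMod.dft x k = C) :
    EVal x = ((d : ℂ)⁻¹ * C) • x := by
  refine ZMod.dft.injective (funext fun k => ?_)
  rw [dft_EVal, map_smul, Pi.smul_apply, smul_eq_mul]
  rcases h k with hk | hk <;> rw [hk] <;> ring

theorem isESolution_iff_dft (hx : x 0 = 1) :
    IsESolution x ↔ ∃ C, ∀ k, ZMod.dft x k = 0 ∨ ZMod.dft x k = C := by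
  have hd : (d : ℂ) ≠ 0 := NeZero.ne _
  constructor
  · refine fun h => ⟨d * EVal x 0, fun k => ?_⟩
    have hk := dft_EVal x k
    rw [h.eVal_eq_smul, map_smul, Pi.smul_apply, smul_eq_mul] at hk
    rw [eq_inv_mul_iff_mul_eq₀ hd, ← mul_assoc, sq] at hk
    exact (mul_eq_mul_right_iff.mp hk.symm).symm
  · rintro ⟨C, h⟩
    have hE := eVal_eq_smul_of_dft h
    refine ⟨hx, fun m _ => ?_⟩
    rw [hE, Pi.smul_apply, Pi.smul_apply, hx, smul_eq_mul, smul_eq_mul, mul_one, mul_comm]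

lemma dft_eSolution_eq_zero_or (D : Finset (ZMod d)) (k : ZMod d) :
    ZMod.dft (eSolution D) k = 0 ∨ ZMod.dft (eSolution D) k = d * (D.card : ℂ)⁻¹ := by
  rw [dft_eSolution]
  split_ifs <;> simp

lemma isESolution_eSolution (hD : D.Nonempty) : IsESolution (eSolution D) :=
  (isESolution_iff_dft (eSolution_zero hD)).mpr ⟨_, dft_eSolution_eq_zero_or D⟩

lemma eVal_eSolution_zero (hD : D.Nonempty) : EVal (eSolution D) 0 = (D.card : ℂ)⁻¹ := by
  rw [eVal_eq_smul_of_dft (dft_eSolution_eq_zero_or D), Pi.smul_apply, eSolution_zero hD,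
    smul_eq_mul, mul_one, inv_mul_cancel_left₀ (NeZero.ne _)]

open Classical in
/-- The part of the support of the Fourier transform of `x` on which it takes the value `C`.
The sets `setD₁` and `setD₂` are the cases `C = -dz` and `C = -dz(u+1)`. -/
def dftLevel (x : ZMod d → ℂ) (C : ℂ) : Finset (ZMod d) :=
  {k | ZMod.dft x k ≠ 0 ∧ ZMod.dft x k = C}

lemma mem_dftLevel {k : ZMod d} :
    k ∈ dftLevel x C ↔ ZMod.dft x k ≠ 0 ∧ ZMod.dft x k = C := by
  simp [dftLevel]

lemma dftLevel_zero (x : ZMod d → ℂ) : dftLevel x 0 = ∅ :=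
  Finset.eq_empty_of_forall_notMem fun _ hk => (mem_dftLevel.mp hk).1 (mem_dftLevel.mp hk).2

lemma eq_eSolution_dftLevel (hx : x 0 = 1) (h : ∀ k, ZMod.dft x k = 0 ∨ ZMod.dft x k = C) :
    (dftLevel x C).Nonempty ∧ C * (dftLevel x C).card = d ∧ x = eSolution (dftLevel x C) := by
  have hd : (d : ℂ) ≠ 0 := NeZero.ne _
  set L := dftLevel x C with hL
  have hdft (k : ZMod d) : ZMod.dft x k = if k ∈ L then C else 0 := by
    rcases h k with hk | hk <;> simp [hL, mem_dftLevel, hk, eq_comm]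
  have hsum : C * L.card = d := by
    have hinv := congrFun (ZMod.dft.symm_apply_apply x) 0
    simp only [ZMod.invDFT_apply, hx, mul_zero, AddChar.map_zero_eq_one, one_mul,
      smul_eq_mul] at hinv
    rw [inv_mul_eq_one₀ hd] at hinv
    rw [hinv, Finset.sum_congr rfl fun k _ => hdft k, Finset.sum_ite_mem, Finset.univ_inter,
      Finset.sum_const, nsmul_eq_mul, mul_comm]
  have hcard : (L.card : ℂ) ≠ 0 := right_ne_zero_of_mul (hsum ▸ hd)
  refine ⟨Finset.card_ne_zero.mp (Nat.cast_ne_zero.mp hcard), hsum,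
    ZMod.dft.injective (funext fun k => ?_)⟩
  rw [hdft, dft_eSolution, ← hsum, mul_inv_cancel_right₀ hcard]

lemma dftLevel_eSolution (hD : D.Nonempty) (C : ℂ) :
    dftLevel (eSolution D) C = if C * D.card = d then D else ∅ := by
  have hcard : (D.card : ℂ) ≠ 0 := Nat.cast_ne_zero.mpr hD.card_pos.ne'
  ext k
  rw [mem_dftLevel, dft_eSolution_ne_zero_iff hD]
  simp only [dft_eSolution, ← eq_mul_inv_iff_mul_eq₀ hcard, eq_comm (b := C)]
  by_cases hk : k ∈ D <;> split_ifs with hC <;> simp [hk, hC]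

theorem existsUnique_eSolution (h : IsESolution x) :
    ∃! D : Finset (ZMod d), D.Nonempty ∧ x = eSolution D := by
  obtain ⟨C, hC⟩ := (isESolution_iff_dft h.1).mp h
  obtain ⟨hne, -, hx⟩ := eq_eSolution_dftLevel h.1 hC
  refine ⟨_, ⟨hne, hx⟩, fun D hD => Finset.ext fun k => ?_⟩
  rw [← dft_eSolution_ne_zero_iff hD.1, ← hD.2, ← dft_eSolution_ne_zero_iff hne, ← hx]

lemma IsESolution.dftLevel_eq_empty_or (h : IsESolution x) {C' : ℂ} (hC : C ≠ C') :
    dftLevel x C = ∅ ∨ dftLevel x C' = ∅ := by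
  obtain ⟨B, hB⟩ := (isESolution_iff_dft h.1).mp h
  by_contra! hne
  obtain ⟨⟨k, hk⟩, l, hl⟩ := hne
  rw [mem_dftLevel] at hk hl
  exact hC (by rw [← hk.2, ← hl.2, (hB k).resolve_left hk.1, (hB l).resolve_left hl.1])

end ESystem

section setD

variable {d : ℕ} [NeZero d] {u z : ℂ} {x : ZMod d → ℂ} {D : Finset (ZMod d)}

lemma setD₁_eq_dftLevel (z : ℂ) (x : ZMod d → ℂ) : setD₁ z x = dftLevel x (-(d * z)) := rfl

lemma setD₂_eq_dftLevel (u z : ℂ) (x : ZMod d → ℂ) :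
    setD₂ u z x = dftLevel x (-(d * z * (u + 1))) := rfl

lemma IsESolution.setD₁_or_setD₂_eq_empty (h : IsESolution x) (hu : u ≠ 0) (z : ℂ) :
    setD₁ z x = ∅ ∨ setD₂ u z x = ∅ := by
  rw [setD₁_eq_dftLevel, setD₂_eq_dftLevel]
  rcases eq_or_ne z 0 with rfl | hz
  · exact Or.inl (by rw [mul_zero, neg_zero, dftLevel_zero])
  · refine h.dftLevel_eq_empty_or fun heq => mul_ne_zero (mul_ne_zero (NeZero.ne (d : ℂ)) hz) hu ?_
    linear_combination heq

lemma setD₂_of_setD₁_eq_empty (hx : x 0 = 1)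
    (h : ∀ k, ZMod.dft x k = 0 ∨ ZMod.dft x k = -(d * z) ∨ ZMod.dft x k = -(d * z * (u + 1)))
    (hD₁ : setD₁ z x = ∅) :
    (setD₂ u z x).Nonempty ∧ x = eSolution (setD₂ u z x) ∧ u + 1 ≠ 0 ∧
      z = -1 / ((u + 1) * (setD₂ u z x).card) := by
  have hd : (d : ℂ) ≠ 0 := NeZero.ne _
  have hlevel (k : ZMod d) : ZMod.dft x k = 0 ∨ ZMod.dft x k = -(d * z * (u + 1)) := by
    have hk : k ∉ setD₁ z x := hD₁ ▸ Finset.notMem_empty k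
    rw [setD₁_eq_dftLevel, mem_dftLevel] at hk
    exact or_iff_not_imp_left.mpr fun h0 =>
      ((h k).resolve_left h0).resolve_left fun h₁ => hk ⟨h0, h₁⟩
  obtain ⟨hne, hcard, heq⟩ := eq_eSolution_dftLevel hx hlevel
  rw [← setD₂_eq_dftLevel] at hne hcard heq
  have hprod : (d : ℂ) * (z * ((u + 1) * (setD₂ u z x).card)) = d * -1 := by
    linear_combination -hcard
  have hz := mul_left_cancel₀ hd hprod
  have hne0 : (u + 1) * ((setD₂ u z x).card : ℂ) ≠ 0 :=
    right_ne_zero_of_mul (hz.trans_ne (neg_ne_zero.mpr one_ne_zero))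
  exact ⟨hne, heq, left_ne_zero_of_mul hne0, eq_div_of_mul_eq hne0 hz⟩

lemma setD₁_of_setD₂_eq_empty (hx : x 0 = 1)
    (h : ∀ k, ZMod.dft x k = 0 ∨ ZMod.dft x k = -(d * z) ∨ ZMod.dft x k = -(d * z * (u + 1)))
    (hD₂ : setD₂ u z x = ∅) :
    (setD₁ z x).Nonempty ∧ x = eSolution (setD₁ z x) ∧ z = -1 / (setD₁ z x).card := by
  have hd : (d : ℂ) ≠ 0 := NeZero.ne _
  have hlevel (k : ZMod d) : ZMod.dft x k = 0 ∨ ZMod.dft x k = -(d * z) := by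
    have hk : k ∉ setD₂ u z x := hD₂ ▸ Finset.notMem_empty k
    rw [setD₂_eq_dftLevel, mem_dftLevel] at hk
    exact or_iff_not_imp_left.mpr fun h0 =>
      ((h k).resolve_left h0).resolve_right fun h₂ => hk ⟨h0, h₂⟩
  obtain ⟨hne, hcard, heq⟩ := eq_eSolution_dftLevel hx hlevel
  rw [← setD₁_eq_dftLevel] at hne hcard heq
  have hprod : (d : ℂ) * (z * (setD₁ z x).card) = d * -1 := by linear_combination -hcard
  exact ⟨hne, heq, eq_div_of_mul_eq (Nat.cast_ne_zero.mpr hne.card_pos.ne')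
    (mul_left_cancel₀ hd hprod)⟩

lemma setD₁_or_setD₂_eq_empty_iff (hu : u ≠ 0) (hx : x 0 = 1)
    (h : ∀ k, ZMod.dft x k = 0 ∨ ZMod.dft x k = -(d * z) ∨ ZMod.dft x k = -(d * z * (u + 1))) :
    setD₁ z x = ∅ ∨ setD₂ u z x = ∅ ↔ IsESolution x := by
  refine ⟨?_, fun hE => hE.setD₁_or_setD₂_eq_empty hu z⟩
  rintro (hD₁ | hD₂)
  · obtain ⟨hne, heq, -⟩ := setD₂_of_setD₁_eq_empty hx h hD₁
    exact heq ▸ isESolution_eSolution hne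
  · obtain ⟨hne, heq, -⟩ := setD₁_of_setD₂_eq_empty hx h hD₂
    exact heq ▸ isESolution_eSolution hne

lemma setD_eSolution_of_add_one (hu : u ≠ 0) (hu1 : u + 1 ≠ 0) (hD : D.Nonempty)
    (hz : z = -1 / ((u + 1) * D.card)) :
    setD₁ z (eSolution D) = ∅ ∧ setD₂ u z (eSolution D) = D := by
  have hd : (d : ℂ) ≠ 0 := NeZero.ne _
  have hcard : (D.card : ℂ) ≠ 0 := Nat.cast_ne_zero.mpr hD.card_pos.ne'
  rw [setD₁_eq_dftLevel, setD₂_eq_dftLevel, dftLevel_eSolution hD, dftLevel_eSolution hD, hz]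
  refine ⟨if_neg ?_, if_pos ?_⟩
  · field_simp
    simpa [eq_comm] using hu
  · field_simp

lemma setD_eSolution (hu : u ≠ 0) (hD : D.Nonempty) (hz : z = -1 / D.card) :
    setD₂ u z (eSolution D) = ∅ ∧ setD₁ z (eSolution D) = D := by
  have hd : (d : ℂ) ≠ 0 := NeZero.ne _
  have hcard : (D.card : ℂ) ≠ 0 := Nat.cast_ne_zero.mpr hD.card_pos.ne'
  rw [setD₁_eq_dftLevel, setD₂_eq_dftLevel, dftLevel_eSolution hD, dftLevel_eSolution hD, hz]
  refine ⟨if_neg ?_, if_pos ?_⟩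
  · field_simp
    simpa using hu
  · field_simp

end setD

/-! ### The framed link invariant -/

section traceInverse

variable {d : ℕ} {u z : ℂ} {x : ZMod d → ℂ} {tr : ∀ n, YH d u n →ₗ[ℂ] ℂ} {n : ℕ}

lemma IsJuyumayaTrace.mul_gLast_mul (h : IsJuyumayaTrace d u z x tr) (a b : YH d u (n + 1)) :
    tr (n + 2) (YH.incl d u (n + 1) a * YH.gLast n * YH.incl d u (n + 1) b)
      = z * tr (n + 1) (b * a) := by
  rw [h.mul_comm, ← mul_assoc, ← map_mul, h.braiding]

variable [NeZero d]

lemma IsJuyumayaTrace.incl_mul_eLast (h : IsJuyumayaTrace d u z x tr) (hx : x 0 = 1)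
    (a : YH d u (n + 1)) :
    tr (n + 2) (YH.incl d u (n + 1) a * YH.eLast n)
      = (d : ℂ)⁻¹
        * ∑ s ∈ Finset.range d, x (-(s : ZMod d)) * tr (n + 1) (a * YH.t (Fin.last n) ^ s) := by
  rw [YH.eLast_eq, framingAverage, mul_smul_comm, map_smul, smul_eq_mul, Finset.mul_sum, map_sum]
  congr 1
  refine Finset.sum_congr rfl fun s hs => ?_
  rw [← YH.incl_t, ← map_pow, ← mul_assoc, ← map_mul, h.incl_mul_t_last_pow hx,
    Nat.cast_sub (Finset.mem_range.mp hs).le, ZMod.natCast_self, zero_sub]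

lemma IsJuyumayaTrace.incl_framingWord_mul_eLast (h : IsJuyumayaTrace d u z x tr)
    (hx : IsESolution x) (a : YH d u n) (m : ℕ) :
    tr (n + 2) (YH.incl d u (n + 1) (YH.incl d u n a * YH.t (Fin.last n) ^ m) * YH.eLast n)
      = EVal x 0 * tr (n + 1) (YH.incl d u n a * YH.t (Fin.last n) ^ m) := by
  have hE : EVal x m = EVal x 0 * x m := congrFun hx.eVal_eq_smul m
  have hsum : ∑ s ∈ Finset.range d, x (-(s : ZMod d)) * x (m + s) = d * EVal x m := by
    rw [sum_range_natCast_zmod fun s => x (-s) * x (m + s), EVal,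
      mul_inv_cancel_left₀ (NeZero.ne _)]
    exact Finset.sum_congr rfl fun s _ => _root_.mul_comm _ _
  rw [h.incl_mul_eLast hx.1, h.incl_mul_t_last_pow hx.1, ← mul_assoc, ← hE]
  simp only [mul_assoc, ← pow_add, h.incl_mul_t_last_pow hx.1, Nat.cast_add]
  simp only [← mul_assoc]
  rw [← Finset.sum_mul, hsum, mul_assoc (d : ℂ), inv_mul_cancel_left₀ (NeZero.ne _)]

lemma IsJuyumayaTrace.incl_braidingWord_mul_eLast (h : IsJuyumayaTrace d u z x tr) (hx : x 0 = 1)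
    (a b : YH d u (n + 1)) :
    tr (n + 3) (YH.incl d u (n + 2)
        (YH.incl d u (n + 1) a * YH.gLast n * YH.incl d u (n + 1) b) * YH.eLast (n + 1))
      = z * tr (n + 2) (YH.incl d u (n + 1) (b * a) * YH.eLast n) := by
  have hmove (s : ℕ) : YH.incl d u (n + 1) a * YH.gLast n * YH.incl d u (n + 1) b
        * YH.t (Fin.last (n + 1)) ^ s
      = YH.incl d u (n + 1) (a * YH.t (Fin.last n) ^ s) * YH.gLast n * YH.incl d u (n + 1) b := by
    have hb := ((YH.commute_t_last_incl b).pow_left s).eq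
    have hg := ((YH.semiconjBy_gLast_t_last (d := d) (u := u) n).pow_right s).eq
    rw [map_mul, map_pow, YH.incl_t, mul_assoc, ← hb, mul_assoc, ← mul_assoc (YH.gLast n), hg]
    simp only [mul_assoc]
  simp only [h.incl_mul_eLast hx, hmove, h.mul_gLast_mul, Finset.mul_sum]
  refine Finset.sum_congr rfl fun s _ => ?_
  rw [← mul_assoc b, mul_left_comm z, mul_left_comm z]

/-- The E-system is the condition under which the trace of `a e_n` depends only on that of `a`. -/
theorem IsJuyumayaTrace.incl_mul_eLast_of_isESolution (h : IsJuyumayaTrace d u z x tr)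
    (hx : IsESolution x) (a : YH d u (n + 1)) :
    tr (n + 2) (YH.incl d u (n + 1) a * YH.eLast n) = EVal x 0 * tr (n + 1) a := by
  let withE (n : ℕ) : YH d u (n + 1) →ₗ[ℂ] ℂ :=
    tr (n + 2) ∘ₗ LinearMap.mulRight ℂ (YH.eLast n) ∘ₗ (YH.incl d u (n + 1)).toLinearMap
  have eqOn_framingWords (n : ℕ) :
      Set.EqOn (withE n) (EVal x 0 • tr (n + 1)) (framingWords d u n) := by
    rintro _ ⟨a, m, rfl⟩
    exact h.incl_framingWord_mul_eLast hx a m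
  suffices hE : ∀ n, withE n = EVal x 0 • tr (n + 1) from LinearMap.congr_fun (hE n) a
  intro n
  induction n with
  | zero => exact LinearMap.ext_on span_framingWords_zero (eqOn_framingWords 0)
  | succ n ih =>
      refine LinearMap.ext_on (wordSpan_eq_top n) ?_
      rintro b (hb | ⟨a, c, rfl⟩)
      · exact eqOn_framingWords (n + 1) hb
      · calc _ = z * withE n (c * a) := h.incl_braidingWord_mul_eLast hx.1 a c
          _ = EVal x 0 * (z * tr (n + 1) (c * a)) := by
            rw [ih, LinearMap.smul_apply, smul_eq_mul, mul_left_comm]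
          _ = _ := by rw [LinearMap.smul_apply, smul_eq_mul, h.mul_gLast_mul]

lemma IsJuyumayaTrace.incl_mul_eLast_mul_gLast (h : IsJuyumayaTrace d u z x tr)
    (a : YH d u (n + 1)) :
    tr (n + 2) (YH.incl d u (n + 1) a * (YH.eLast n * YH.gLast n)) = z * tr (n + 1) a := by
  have hterm (s : ℕ) (hs : s ∈ Finset.range d) :
      tr (n + 2) (YH.incl d u (n + 1) a
        * (YH.t (Fin.last n).castSucc ^ s * YH.t (Fin.last (n + 1)) ^ (d - s) * YH.gLast n))
      = z * tr (n + 1) a := by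
    rw [mul_assoc (_ ^ s), ← ((YH.semiconjBy_gLast_t_castSucc_last n).pow_right (d - s)).eq,
      ← YH.incl_t, ← map_pow, ← map_pow, ← mul_assoc, ← mul_assoc, ← map_mul, h.mul_gLast_mul,
      h.mul_comm, mul_assoc, ← pow_add, Nat.add_sub_cancel' (Finset.mem_range.mp hs).le,
      YH.framing_pow, mul_one]
  rw [YH.eLast_eq, framingAverage, smul_mul_assoc, mul_smul_comm, map_smul, Finset.sum_mul,
    Finset.mul_sum, map_sum, Finset.sum_congr rfl hterm, Finset.sum_const, Finset.card_range,
    nsmul_eq_mul, smul_eq_mul, inv_mul_cancel_left₀ (NeZero.ne _)]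

lemma IsJuyumayaTrace.incl_mul_gInv (h : IsJuyumayaTrace d u z x tr) (hx : IsESolution x)
    (hu : u ≠ 0) (a : YH d u (n + 1)) :
    tr (n + 2) (YH.incl d u (n + 1) a * YH.gInv n (Nat.lt_succ_self _))
      = (z + (1 - u) * EVal x 0) / u * tr (n + 1) a := by
  simp only [YH.gInv, mul_add, mul_smul_comm, map_add, map_smul, h.braiding,
    h.incl_mul_eLast_of_isESolution hx, h.incl_mul_eLast_mul_gLast, smul_eq_mul]
  field_simp
  ring

end traceInverse

section invariant

variable {d : ℕ} [NeZero d] {u : ℂ} (hu : u ≠ 0) {n : ℕ}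

lemma gammaRep_σ (i : ℕ) (hi : i + 1 < n) :
    (gammaRep (d := d) hu n (FramedBraidGroup.σ i hi) : YH d u n) = YH.g i hi := by
  simp [gammaRep, FramedBraidGroup.lift, FramedBraidGroup.σ, YH.unitGen]

lemma gammaRep_σ_inv (i : ℕ) (hi : i + 1 < n) :
    (gammaRep (d := d) hu n (FramedBraidGroup.σ i hi)⁻¹ : YH d u n) = YH.gInv i hi := by
  simp [gammaRep, FramedBraidGroup.lift, FramedBraidGroup.σ, YH.unitGen]

lemma gammaRep_incl (α : FramedBraidGroup n) :
    (gammaRep (d := d) hu (n + 1) (FramedBraidGroup.incl n α) : YH d u (n + 1))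
      = YH.incl d u n ((gammaRep hu n α : (YH d u n)ˣ) : YH d u n) := by
  have hcomp : (gammaRep (d := d) hu (n + 1)).comp (FramedBraidGroup.incl n)
      = (Units.map (YH.incl d u n : YH d u n →* YH d u (n + 1))).comp (gammaRep hu n) := by
    refine PresentedGroup.ext fun x => Units.ext ?_
    cases x <;> simp [gammaRep, FramedBraidGroup.incl, FramedBraidGroup.inclGen,
      FramedBraidGroup.lift, FramedBraidGroup.σ, FramedBraidGroup.t, YH.unitGen, YH.incl_g,
      YH.incl_t]
  exact congrArg Units.val (DFunLike.congr_fun hcomp α)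

lemma exponent_incl (α : FramedBraidGroup n) :
    FramedBraidGroup.exponent (n + 1) (FramedBraidGroup.incl n α)
      = FramedBraidGroup.exponent n α := by
  have hcomp : (FramedBraidGroup.exponent (n + 1)).comp (FramedBraidGroup.incl n)
      = FramedBraidGroup.exponent n := by
    refine PresentedGroup.ext fun x => ?_
    cases x <;> simp [FramedBraidGroup.exponent, FramedBraidGroup.incl, FramedBraidGroup.inclGen,
      FramedBraidGroup.lift, FramedBraidGroup.σ, FramedBraidGroup.t]
  exact DFunLike.congr_fun hcomp α

lemma exponent_σ (i : ℕ) (hi : i + 1 < n) :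
    FramedBraidGroup.exponent n (FramedBraidGroup.σ i hi) = Multiplicative.ofAdd 1 := by
  simp [FramedBraidGroup.exponent, FramedBraidGroup.lift, FramedBraidGroup.σ]

variable {z s : ℂ} {D : Finset (ZMod d)} {tr : ∀ n, YH d u n →ₗ[ℂ] ℂ}

theorem gammaValue_eq_of_move (h : IsJuyumayaTrace d u z (eSolution D) tr) (hD : D.Nonempty)
    (hz : z ≠ 0) (hs : s ≠ 0) (hsq : s ^ 2 = lambdaD u z D)
    {α β : Σ n : ℕ, FramedBraidGroup (n + 1)} (hαβ : FramedMarkovMove α β) :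
    gammaValue hu z s tr α.2 = gammaValue hu z s tr β.2 := by
  cases hαβ with
  | conj n α β =>
      simp only [gammaValue, map_mul, map_inv, mul_inv_cancel_comm, Units.val_mul]
      rw [h.mul_comm, ← mul_assoc, Units.inv_mul, one_mul]
  | stabPos n α =>
      simp only [gammaValue, map_mul, Units.val_mul, gammaRep_incl, gammaRep_σ, h.braiding,
        exponent_incl, exponent_σ, toAdd_mul, toAdd_ofAdd, zpow_add₀ hs, zpow_one, pow_succ]
      field_simp
  | stabNeg n α =>
      have hcard : (D.card : ℂ) ≠ 0 := Nat.cast_ne_zero.mpr hD.card_pos.ne'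
      have hlambda : (z + (1 - u) * (D.card : ℂ)⁻¹) / u = z * s ^ 2 := by
        rw [hsq, lambdaD]
        field_simp
        ring
      rw [gammaValue, gammaValue, map_mul (gammaRep hu _), Units.val_mul, gammaRep_incl,
        gammaRep_σ_inv, h.incl_mul_gInv (isESolution_eSolution hD) hu, eVal_eSolution_zero hD,
        hlambda, map_mul, map_inv, exponent_incl, exponent_σ, toAdd_mul, toAdd_inv, toAdd_ofAdd,
        zpow_add₀ hs, zpow_neg, zpow_one, pow_succ]
      field_simp

lemma lambdaD_eq {d : ℕ} {D : Finset (ZMod d)} (hu : u ≠ 0) (hu1 : u + 1 ≠ 0) (hD : D.Nonempty)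
    (hz : z = -1 / ((u + 1) * D.card)) : lambdaD u z D = u := by
  have hcard : (D.card : ℂ) ≠ 0 := Nat.cast_ne_zero.mpr hD.card_pos.ne'
  rw [lambdaD, hz]
  field_simp
  ring

theorem exists_framedLink_invariant (hu1 : u + 1 ≠ 0) (hD : D.Nonempty)
    (hz : z = -1 / ((u + 1) * D.card)) (hs : s ^ 2 = u)
    (h : IsJuyumayaTrace d u z (eSolution D) tr) :
    ∃ V : FramedLink → ℂ, ∀ (n : ℕ) (α : FramedBraidGroup (n + 1)),
      V (braidClosure α) = gammaValue hu z s tr α := by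
  have hz0 : z ≠ 0 := hz ▸ div_ne_zero (neg_ne_zero.mpr one_ne_zero)
    (mul_ne_zero hu1 (Nat.cast_ne_zero.mpr hD.card_pos.ne'))
  have hs0 : s ≠ 0 := pow_ne_zero_iff two_ne_zero |>.mp (hs.trans_ne hu)
  have hsq : s ^ 2 = lambdaD u z D := hs.trans (lambdaD_eq hu hu1 hD hz).symm
  exact ⟨Quot.lift (fun α => gammaValue hu z s tr α.2)
    fun _ _ => gammaValue_eq_of_move hu h hD hz0 hs0 hsq, fun _ _ => rfl⟩

end invariant

end

end FramizationTL

theorem mainTheorem2 (d : ℕ) [NeZero d] (u : ℂ) (hu : u ≠ 0) :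
    -- the trace is unique
    (∀ (z : ℂ) (x : ZMod d → ℂ) (tr tr' : ∀ n, YH d u n →ₗ[ℂ] ℂ), x 0 = 1 →
      IsJuyumayaTrace d u z x tr → IsJuyumayaTrace d u z x tr' → tr = tr') ∧
    -- the solutions of the E-system are parametrized by the non-empty sets of residues
    (∀ D : Finset (ZMod d), D.Nonempty → IsESolution (eSolution D)) ∧
    (∀ x : ZMod d → ℂ, IsESolution x →
      ∃! D : Finset (ZMod d), D.Nonempty ∧ x = eSolution D) ∧
    -- trace parameters for which the trace passes
    (∀ n, 3 ≤ n → ∀ (z : ℂ) (x : ZMod d → ℂ), x 0 = 1 → TracePasses d u n z x →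
      ((setD₁ z x = ∅ ∨ setD₂ u z x = ∅) ↔ IsESolution x) ∧
      (setD₁ z x = ∅ → (setD₂ u z x).Nonempty ∧ x = eSolution (setD₂ u z x) ∧
        u + 1 ≠ 0 ∧ z = -1 / ((u + 1) * (setD₂ u z x).card)) ∧
      (setD₂ u z x = ∅ → (setD₁ z x).Nonempty ∧ x = eSolution (setD₁ z x) ∧
        z = -1 / (setD₁ z x).card)) ∧
    -- the trace passes for every solution of the E-system
    (∀ n, 3 ≤ n → ∀ D : Finset (ZMod d), D.Nonempty → ∀ z : ℂ,
      (u + 1 ≠ 0 → z = -1 / ((u + 1) * D.card) → TracePasses d u n z (eSolution D) ∧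
        setD₁ z (eSolution D) = ∅ ∧ setD₂ u z (eSolution D) = D) ∧
      (z = -1 / D.card → TracePasses d u n z (eSolution D) ∧
        setD₂ u z (eSolution D) = ∅ ∧ setD₁ z (eSolution D) = D)) ∧
    -- the framed Jones polynomial is well defined
    (∀ D : Finset (ZMod d), D.Nonempty → u + 1 ≠ 0 →
      ∀ z : ℂ, z = -1 / ((u + 1) * D.card) →
        lambdaD u z D = u ∧
        ∀ s : ℂ, s ^ 2 = u →
          ∃ tr : ∀ n, YH d u n →ₗ[ℂ] ℂ, IsJuyumayaTrace d u z (eSolution D) tr ∧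
            ∃ V : FramedLink → ℂ, ∀ (n : ℕ) (α : FramedBraidGroup (n + 1)),
              V (braidClosure α) = gammaValue hu z s tr α) := by
  refine ⟨fun z x tr tr' hx h h' => h.unique hx h', fun D hD => isESolution_eSolution hD,
    fun x h => existsUnique_eSolution h, fun n hn z x hx hpasses => ?_,
    fun n _ D hD z => ⟨fun hu1 hz => ?_, fun hz => ?_⟩, fun D hD hu1 z hz => ?_⟩
  · have hdft := dft_of_tracePasses hn hx hpasses
    exact ⟨setD₁_or_setD₂_eq_empty_iff hu hx hdft, setD₂_of_setD₁_eq_empty hx hdft,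
      setD₁_of_setD₂_eq_empty hx hdft⟩
  · exact ⟨hz ▸ tracePasses_eSolution_of_add_one n hu1 hD,
      setD_eSolution_of_add_one hu hu1 hD hz⟩
  · exact ⟨hz ▸ tracePasses_eSolution n hD, setD_eSolution hu hD hz⟩
  · obtain ⟨tr, htr, -⟩ : TracePasses d u 0 z (eSolution D) :=
      hz ▸ tracePasses_eSolution_of_add_one 0 hu1 hD
    exact ⟨lambdaD_eq hu hu1 hD hz, fun s hs =>
      ⟨tr, htr, exists_framedLink_invariant hu hu1 hD hz hs htr⟩⟩
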